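/- Running times are measured on a real RAM. Its memory consists of scalar registers and arrays, some holding natural numbers and some holding real numbers. Unit-cost operations are reading and assigning a register or an array cell (array cells are addressed by computed natural numbers), addition, truncated subtraction and halving (rounded down) of natural numbers, the operations $+,-,\times,/$ and $\sqrt{\phantom{x}}$ on real numbers, exact comparisons of natural numbers and of real numbers, Boolean combinations of tests, and branching. Natural-number and rational constants may occur in the program; division by zero and square roots of negative numbers return $0$; there is no rounding and no other conversion from real numbers to natural numbers. Theorem. There is a single real-RAM program with the following property. Given any $n$ and any polygonal curve $\langle p_1,\dots,p_n\rangle$ in the plane $\mathbb{R}^2$ (as the number $n$ and the arrays of the $x$- and $y$-coordinates of the vertices, all other memory being initially $0$), the program halts and has stored, for all pairs $1\le i<j\le n$, the Hausdorff distance $$\varepsilon(p_i,p_j)=\max\Big\{\max_{x\in \overline{p_ip_j}}\ \min_{y\in C_{i,j}}\|x-y\|,\ \max_{y\in C_{i,j}}\ \min_{x\in \overline{p_ip_j}}\|x-y\|\Big\}$$ between the line segment $\overline{p_ip_j}$ and the subcurve $C_{i,j}=\bigcup_{k=i}^{j-1}\overline{p_kp_{k+1}}$, in an array indexed row by row by the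 pairs $(i,j)$. Its total running time is $O(n^2\log n)$, with an absolute implied constant: its worst-case number of steps over all curves with $n$ vertices is at most $T(n)$ for a function $T:\mathbb{N}\to\mathbb{N}$ with $T(n)=O(n^2\log n)$ as $n\to\infty$. -/

import Mathlib

open Filter Asymptotics

noncomputable section

namespace RealRAM

/-! A real RAM, presented as a structured imperative language with unit-cost operations.
The memory consists of natural-number and real-number scalar registers, and of natural-number and
real-number arrays with unbounded index range. Registers and arrays are named by numerals that are
fixed in the program text; array cells are addressed indirectly by computed natural numbers. -/

/-- A memory configuration: `nat x` and `real x` are the scalar registers named `x`,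
`natArr a k` and `realArr a k` are the `k`-th cells of the arrays named `a`. -/
@[ext] structure State where
  nat : ℕ → ℕ
  real : ℕ → ℝ
  natArr : ℕ → ℕ → ℕ
  realArr : ℕ → ℕ → ℝ

/-- Write `v` to the natural-number register `x`. -/
def State.setNat (s : State) (x v : ℕ) : State :=
  { s with nat := Function.update s.nat x v }

/-- Write `v` to the real register `x`. -/
def State.setReal (s : State) (x : ℕ) (v : ℝ) : State :=
  { s with real := Function.update s.real x v }

/-- Write `v` to the `k`-th cell of the natural-number array `a`. -/
def State.storeNat (s : State) (a k v : ℕ) : State :=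
  { s with natArr := Function.update s.natArr a (Function.update (s.natArr a) k v) }

/-- Write `v` to the `k`-th cell of the real array `a`. -/
def State.storeReal (s : State) (a k : ℕ) (v : ℝ) : State :=
  { s with realArr := Function.update s.realArr a (Function.update (s.realArr a) k v) }

/-- Natural-number expressions: constants, register and array reads, addition, truncated
subtraction, and halving. There is no multiplication and no conversion from reals. -/
inductive NExp where
  | const (c : ℕ)
  | reg (x : ℕ)
  | cell (a : ℕ) (k : NExp)
  | add (e f : NExp)
  | sub (e f : NExp)
  | half (e : NExp)

/-- Real expressions: rational constants, register and array reads, the four arithmetic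
operations, and the square root. There is no rounding. -/
inductive RExp where
  | const (c : ℚ)
  | reg (x : ℕ)
  | cell (a : ℕ) (k : NExp)
  | add (e f : RExp)
  | sub (e f : RExp)
  | mul (e f : RExp)
  | div (e f : RExp)
  | sqrt (e : RExp)

/-- Tests: exact comparisons of naturals and of reals, and Boolean combinations. -/
inductive Test where
  | natLE (e f : NExp)
  | realLE (e f : RExp)
  | neg (b : Test)
  | conj (b c : Test)

/-- Programs. A program is a finite object that does not depend on the input. -/
inductive Prog where
  | skip
  | setNat (x : ℕ) (e : NExp)
  | setReal (x : ℕ) (e : RExp)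
  | storeNat (a : ℕ) (k : NExp) (e : NExp)
  | storeReal (a : ℕ) (k : NExp) (e : RExp)
  | seq (P Q : Prog)
  | ite (b : Test) (P Q : Prog)
  | loop (b : Test) (P : Prog)

/-- The value of a natural-number expression. -/
def NExp.eval (s : State) : NExp → ℕ
  | .const c => c
  | .reg x => s.nat x
  | .cell a k => s.natArr a (k.eval s)
  | .add e f => e.eval s + f.eval s
  | .sub e f => e.eval s - f.eval s
  | .half e => e.eval s / 2

/-- The number of unit-cost operations needed to evaluate a natural-number expression. -/
def NExp.cost : NExp → ℕ
  | .const _ => 1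
  | .reg _ => 1
  | .cell _ k => k.cost + 1
  | .add e f => e.cost + f.cost + 1
  | .sub e f => e.cost + f.cost + 1
  | .half e => e.cost + 1

/-- The value of a real expression. Division by zero and the square root of a negative number
return `0`; a program can test for these cases by comparisons. -/
def RExp.eval (s : State) : RExp → ℝ
  | .const c => (c : ℝ)
  | .reg x => s.real x
  | .cell a k => s.realArr a (k.eval s)
  | .add e f => e.eval s + f.eval s
  | .sub e f => e.eval s - f.eval s
  | .mul e f => e.eval s * f.eval s
  | .div e f => e.eval s / f.eval s
  | .sqrt e => Real.sqrt (e.eval s)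

/-- The number of unit-cost operations needed to evaluate a real expression. -/
def RExp.cost : RExp → ℕ
  | .const _ => 1
  | .reg _ => 1
  | .cell _ k => k.cost + 1
  | .add e f => e.cost + f.cost + 1
  | .sub e f => e.cost + f.cost + 1
  | .mul e f => e.cost + f.cost + 1
  | .div e f => e.cost + f.cost + 1
  | .sqrt e => e.cost + 1

/-- The truth of a test. -/
def Test.Holds (s : State) : Test → Prop
  | .natLE e f => e.eval s ≤ f.eval s
  | .realLE e f => e.eval s ≤ f.eval s
  | .neg b => ¬ b.Holds s
  | .conj b c => b.Holds s ∧ c.Holds s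

/-- The number of unit-cost operations needed to evaluate a test. -/
def Test.cost : Test → ℕ
  | .natLE e f => e.cost + f.cost + 1
  | .realLE e f => e.cost + f.cost + 1
  | .neg b => b.cost + 1
  | .conj b c => b.cost + c.cost + 1

/-- `Exec P s s' t`: started in configuration `s`, the program `P` halts in configuration `s'`
after exactly `t` steps. Every evaluated operation of an expression, every assignment, and every
branching decision (including each decision of a loop to go on or to stop) is one step. -/
inductive Exec : Prog → State → State → ℕ → Prop
  | skip (s : State) : Exec .skip s s 1
  | setNat (s : State) (x : ℕ) (e : NExp) :
      Exec (.setNat x e) s (s.setNat x (e.eval s)) (e.cost + 1)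
  | setReal (s : State) (x : ℕ) (e : RExp) :
      Exec (.setReal x e) s (s.setReal x (e.eval s)) (e.cost + 1)
  | storeNat (s : State) (a : ℕ) (k : NExp) (e : NExp) :
      Exec (.storeNat a k e) s
        (s.storeNat a (k.eval s) (e.eval s)) (k.cost + e.cost + 1)
  | storeReal (s : State) (a : ℕ) (k : NExp) (e : RExp) :
      Exec (.storeReal a k e) s
        (s.storeReal a (k.eval s) (e.eval s)) (k.cost + e.cost + 1)
  | seq {P Q : Prog} {s₀ s₁ s₂ : State} {t u : ℕ} (hP : Exec P s₀ s₁ t) (hQ : Exec Q s₁ s₂ u) :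
      Exec (.seq P Q) s₀ s₂ (t + u)
  | iteTrue {b : Test} {P Q : Prog} {s s' : State} {t : ℕ} (hb : b.Holds s)
      (hP : Exec P s s' t) : Exec (.ite b P Q) s s' (b.cost + 1 + t)
  | iteFalse {b : Test} {P Q : Prog} {s s' : State} {t : ℕ} (hb : ¬ b.Holds s)
      (hQ : Exec Q s s' t) : Exec (.ite b P Q) s s' (b.cost + 1 + t)
  | loopTrue {b : Test} {P : Prog} {s₀ s₁ s₂ : State} {t u : ℕ} (hb : b.Holds s₀)
      (hP : Exec P s₀ s₁ t) (hW : Exec (.loop b P) s₁ s₂ u) :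
      Exec (.loop b P) s₀ s₂ (b.cost + 1 + t + u)
  | loopFalse {b : Test} {P : Prog} {s : State} (hb : ¬ b.Holds s) :
      Exec (.loop b P) s s (b.cost + 1)

/-- Execution is deterministic, in its result and in its running time. -/
theorem Exec.deterministic {P : Prog} {s s₁ s₂ : State} {t₁ t₂ : ℕ}
    (h₁ : Exec P s s₁ t₁) (h₂ : Exec P s s₂ t₂) : s₁ = s₂ ∧ t₁ = t₂ := by
  induction h₁ generalizing s₂ t₂ with
  | skip => cases h₂; exact ⟨rfl, rfl⟩
  | setNat => cases h₂; exact ⟨rfl, rfl⟩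
  | setReal => cases h₂; exact ⟨rfl, rfl⟩
  | storeNat => cases h₂; exact ⟨rfl, rfl⟩
  | storeReal => cases h₂; exact ⟨rfl, rfl⟩
  | seq _ _ ihP ihQ =>
    cases h₂ with
    | seq hP hQ =>
      obtain ⟨rfl, rfl⟩ := ihP hP
      obtain ⟨rfl, rfl⟩ := ihQ hQ
      exact ⟨rfl, rfl⟩
  | iteTrue hb _ ih =>
    cases h₂ with
    | iteTrue _ h => obtain ⟨rfl, rfl⟩ := ih h; exact ⟨rfl, rfl⟩
    | iteFalse hb' _ => exact absurd hb hb'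
  | iteFalse hb _ ih =>
    cases h₂ with
    | iteTrue hb' _ => exact absurd hb' hb
    | iteFalse _ h => obtain ⟨rfl, rfl⟩ := ih h; exact ⟨rfl, rfl⟩
  | loopTrue hb _ _ ihP ihW =>
    cases h₂ with
    | loopTrue _ hP hW =>
      obtain ⟨rfl, rfl⟩ := ihP hP
      obtain ⟨rfl, rfl⟩ := ihW hW
      exact ⟨rfl, rfl⟩
    | loopFalse hb' => exact absurd hb hb'
  | loopFalse hb =>
    cases h₂ with
    | loopTrue hb' _ _ => exact absurd hb' hb
    | loopFalse _ => exact ⟨rfl, rfl⟩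

/-- The initial configuration for a list of `n` points in the plane: register `0` holds `n`, the
real arrays `0` and `1` hold the `x`- and the `y`-coordinates, and everything else is zero. -/
def input {n : ℕ} (p : Fin n → EuclideanSpace ℝ (Fin 2)) : State where
  nat x := if x = 0 then n else 0
  real _ := 0
  natArr _ _ := 0
  realArr a k :=
    if h : k < n then
      if a = 0 then p ⟨k, h⟩ 0 else if a = 1 then p ⟨k, h⟩ 1 else 0
    else 0

end RealRAM

/-- The subcurve `⟨p i, …, p j⟩` of the polygonal curve with vertices `p`, as a set of points of
the plane: the union of the edges between consecutive vertices from `p i` to `p j`. -/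
def subcurve {n : ℕ} (p : Fin n → EuclideanSpace ℝ (Fin 2)) (i j : Fin n) :
    Set (EuclideanSpace ℝ (Fin 2)) :=
  {x | ∃ k l : Fin n, i ≤ k ∧ (l : ℕ) = (k : ℕ) + 1 ∧ l ≤ j ∧ x ∈ segment ℝ (p k) (p l)}

end

/-!
The Hausdorff distance between a segment and a polygonal subcurve with the same end points is the
maximal distance of a vertex of the subcurve from the segment (`hausdorffDist_le_iff`). One half of
this is convexity of the distance from the segment on every edge. For the other half, the subcurve
is connected, so its orthogonal projection to the line through the end points covers the segment;
hence no point of the segment is farther from the subcurve than some point of the subcurve is from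
the segment. The distance from a segment is the larger one of the distances from the two rays that
start at one end point and pass through the other one (`infDist_segment_le_iff`), so it suffices to
find, for each base point `p i` and each `j`, the maximal distance of the vertices between them from
the ray from `p i` to `p j` (`RayLE`), in time `O(n log n)` for each `i`.

For a fixed base point, this is done by an incremental sweep over `j`. The distance of a point from
a ray is its distance from the line of the ray, or its distance from the base point if it lies behind
the base point. As functions of the direction of the line, in sorted order, both the signed
distances from the line (up to a common factor) and the distances from the base point, restricted
to the directions for which the point lies behind, have the property that two of them exchange
their order at most once (`crossVal_singleCrossing`, `stepVal_singleCrossing`). The directions are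
sorted once per base point by merge sort (`sortProg_runs`). The upper envelope of the functions
inserted so far is maintained in a binary tree over the sorted directions, each of whose nodes
carries one function (a Li Chao tree). On insertion of a function, the one that is larger in the
middle of the range of a node stays there, and the other one, which by single crossing can be larger
on one side only, descends to that side (`insertProg_runs`). A query takes the maximum over the path
from a leaf to the root (`queryProg_runs`). Both take time `O(log n)`.

All specifications describe stored maxima by their upper bounds. Programs are verified by a small
logic for total correctness with running times (`Runs`). The names of the registers and arrays that
are assigned in a program text yield, for every execution, the part of the memory that is left
unchanged (`Frame`).

Memory layout. Natural-number registers: `0` the number `n` of vertices, `1` the least power of two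
`M ≥ n`, `2` the index of the base point, `3` the distance of the index of the current point from
it, `4` to `9` sorting, `10` to `17` insertion, `18` and `19` queries, `20` row offsets. Real
registers: `0` the result of a query, `1` the distance from the ray. Natural-number arrays: `0` the
row offsets of the output, `1` the sorted directions, `2` the target of merging, `3` the positions of
the directions in sorted order, `4` to `6` the trees for the distances from the line and for the two
orientations of the ray. Real arrays: `0` and `1` the vertices, `2` the output, `3` and `4` the vectors
from the base point (numbers below `M`) and their opposites (numbers from `M` on), `5` and `6` the
representatives of the directions.
-/

noncomputable section

namespace RealRAM

/-! ### A program logic for total correctness with running times -/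

/-- Started in `s`, the program `P` halts within `T` steps in a configuration satisfying `Q`. -/
def Runs (P : Prog) (s : State) (T : ℕ) (Q : State → Prop) : Prop :=
  ∃ s' t, Exec P s s' t ∧ t ≤ T ∧ Q s'

/-- The natural-number registers that occur as targets of assignments in a program. -/
def Prog.natRegs : Prog → List ℕ
  | .setNat x _ => [x]
  | .seq P Q => P.natRegs ++ Q.natRegs
  | .ite _ P Q => P.natRegs ++ Q.natRegs
  | .loop _ P => P.natRegs
  | _ => []

/-- The real registers that occur as targets of assignments in a program. -/
def Prog.realRegs : Prog → List ℕ
  | .setReal x _ => [x]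
  | .seq P Q => P.realRegs ++ Q.realRegs
  | .ite _ P Q => P.realRegs ++ Q.realRegs
  | .loop _ P => P.realRegs
  | _ => []

/-- The natural-number arrays that a program may write to. -/
def Prog.natArrs : Prog → List ℕ
  | .storeNat a _ _ => [a]
  | .seq P Q => P.natArrs ++ Q.natArrs
  | .ite _ P Q => P.natArrs ++ Q.natArrs
  | .loop _ P => P.natArrs
  | _ => []

/-- The real arrays that a program may write to. -/
def Prog.realArrs : Prog → List ℕ
  | .storeReal a _ _ => [a]
  | .seq P Q => P.realArrs ++ Q.realArrs
  | .ite _ P Q => P.realArrs ++ Q.realArrs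
  | .loop _ P => P.realArrs
  | _ => []

/-- `s'` differs from `s` only in registers and arrays that `P` may write to. -/
structure Frame (P : Prog) (s s' : State) : Prop where
  nat : ∀ x, x ∉ P.natRegs → s'.nat x = s.nat x
  real : ∀ x, x ∉ P.realRegs → s'.real x = s.real x
  natArr : ∀ a, a ∉ P.natArrs → s'.natArr a = s.natArr a
  realArr : ∀ a, a ∉ P.realArrs → s'.realArr a = s.realArr a

theorem Frame.refl (P : Prog) (s : State) : Frame P s s :=
  ⟨fun _ _ => rfl, fun _ _ => rfl, fun _ _ => rfl, fun _ _ => rfl⟩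

theorem Frame.trans {P : Prog} {s₀ s₁ s₂ : State} (h : Frame P s₀ s₁) (h' : Frame P s₁ s₂) :
    Frame P s₀ s₂ :=
  ⟨fun x hx => (h'.nat x hx).trans (h.nat x hx), fun x hx => (h'.real x hx).trans (h.real x hx),
    fun x hx => (h'.natArr x hx).trans (h.natArr x hx),
    fun x hx => (h'.realArr x hx).trans (h.realArr x hx)⟩

theorem Frame.mono {P Q : Prog} {s s' : State} (h : Frame P s s')
    (h₁ : P.natRegs ⊆ Q.natRegs) (h₂ : P.realRegs ⊆ Q.realRegs)
    (h₃ : P.natArrs ⊆ Q.natArrs) (h₄ : P.realArrs ⊆ Q.realArrs) : Frame Q s s' :=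
  ⟨fun x hx => h.nat x fun h' => hx (h₁ h'), fun x hx => h.real x fun h' => hx (h₂ h'),
    fun x hx => h.natArr x fun h' => hx (h₃ h'), fun x hx => h.realArr x fun h' => hx (h₄ h')⟩

section StateLemmas
variable (s : State) (x y a k v : ℕ) (r : ℝ)

@[simp] theorem setNat_nat : (s.setNat x v).nat y = if y = x then v else s.nat y := by
  simp [State.setNat, Function.update_apply]
@[simp] theorem setNat_real : (s.setNat x v).real = s.real := rfl
@[simp] theorem setNat_natArr : (s.setNat x v).natArr = s.natArr := rfl
@[simp] theorem setNat_realArr : (s.setNat x v).realArr = s.realArr := rfl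
@[simp] theorem setReal_real : (s.setReal x r).real y = if y = x then r else s.real y := by
  simp [State.setReal, Function.update_apply]
@[simp] theorem setReal_nat : (s.setReal x r).nat = s.nat := rfl
@[simp] theorem setReal_natArr : (s.setReal x r).natArr = s.natArr := rfl
@[simp] theorem setReal_realArr : (s.setReal x r).realArr = s.realArr := rfl
@[simp] theorem storeNat_natArr : (s.storeNat a k v).natArr y =
    if y = a then Function.update (s.natArr a) k v else s.natArr y := by
  simp [State.storeNat, Function.update_apply]
@[simp] theorem storeNat_nat : (s.storeNat a k v).nat = s.nat := rfl
@[simp] theorem storeNat_real : (s.storeNat a k v).real = s.real := rfl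
@[simp] theorem storeNat_realArr : (s.storeNat a k v).realArr = s.realArr := rfl
@[simp] theorem storeReal_realArr : (s.storeReal a k r).realArr y =
    if y = a then Function.update (s.realArr a) k r else s.realArr y := by
  simp [State.storeReal, Function.update_apply]
@[simp] theorem storeReal_nat : (s.storeReal a k r).nat = s.nat := rfl
@[simp] theorem storeReal_real : (s.storeReal a k r).real = s.real := rfl
@[simp] theorem storeReal_natArr : (s.storeReal a k r).natArr = s.natArr := rfl

end StateLemmas

theorem Exec.frame {P : Prog} {s s' : State} {t : ℕ} (h : Exec P s s' t) : Frame P s s' := by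
  induction h with
  | skip => exact Frame.refl _ _
  | setNat s x e => constructor <;> simp +contextual [Prog.natRegs]
  | setReal s x e => constructor <;> simp +contextual [Prog.realRegs]
  | storeNat s a k e => constructor <;> simp +contextual [Prog.natArrs]
  | storeReal s a k e => constructor <;> simp +contextual [Prog.realArrs]
  | seq _ _ h₁ h₂ =>
    exact (h₁.mono (List.subset_append_left _ _) (List.subset_append_left _ _)
      (List.subset_append_left _ _) (List.subset_append_left _ _)).trans
      (h₂.mono (List.subset_append_right _ _) (List.subset_append_right _ _)
      (List.subset_append_right _ _) (List.subset_append_right _ _))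
  | iteTrue _ _ h =>
    exact h.mono (List.subset_append_left _ _) (List.subset_append_left _ _)
      (List.subset_append_left _ _) (List.subset_append_left _ _)
  | iteFalse _ _ h =>
    exact h.mono (List.subset_append_right _ _) (List.subset_append_right _ _)
      (List.subset_append_right _ _) (List.subset_append_right _ _)
  | loopTrue _ _ _ h₁ h₂ => exact Frame.trans ⟨h₁.1, h₁.2, h₁.3, h₁.4⟩ h₂
  | loopFalse => exact Frame.refl _ _

theorem Runs.mono {P : Prog} {s : State} {T T' : ℕ} {Q Q' : State → Prop} (h : Runs P s T Q)
    (hT : T ≤ T') (hQ : ∀ s', Frame P s s' → Q s' → Q' s') : Runs P s T' Q' := by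
  obtain ⟨s', t, he, ht, hq⟩ := h
  exact ⟨s', t, he, ht.trans hT, hQ s' he.frame hq⟩

theorem Runs.seq {P P' : Prog} {s : State} {T T' : ℕ} {Q : State → Prop}
    (h : Runs P s T fun s' => Runs P' s' T' Q) : Runs (.seq P P') s (T + T') Q := by
  obtain ⟨s', t, he, ht, s'', t', he', ht', hq⟩ := h
  exact ⟨s'', t + t', .seq he he', by omega, hq⟩

/-- Rule for loops with an invariant indexed by the number of completed rounds. -/
theorem Runs.loop {b : Test} {P : Prog} {s₀ : State} {N T : ℕ} (I : ℕ → State → Prop)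
    (h₀ : I 0 s₀)
    (hstep : ∀ k < N, ∀ s, Frame P s₀ s → I k s → b.Holds s ∧ Runs P s T (I (k + 1)))
    (hend : ∀ s, Frame P s₀ s → I N s → ¬ b.Holds s) :
    Runs (.loop b P) s₀ (N * (b.cost + 1 + T) + (b.cost + 1)) (I N) := by
  have key : ∀ m k, k + m = N → ∀ s, Frame P s₀ s → I k s →
      Runs (.loop b P) s (m * (b.cost + 1 + T) + (b.cost + 1)) (I N) := by
    intro m
    induction m with
    | zero =>
      intro k hk s hF hI
      obtain rfl : k = N := by omega
      exact ⟨s, _, .loopFalse (hend s hF hI), by simp, hI⟩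
    | succ m ih =>
      intro k hk s hF hI
      obtain ⟨hb, s', t, he, ht, hI'⟩ := hstep k (by omega) s hF hI
      obtain ⟨s'', t', he', ht', hI''⟩ := ih (k + 1) (by omega) s' (hF.trans he.frame) hI'
      refine ⟨s'', _, .loopTrue hb he he', ?_, hI''⟩
      rw [Nat.succ_mul]; omega
  exact key N 0 (by omega) s₀ (Frame.refl _ _) h₀

/-! ### Loop-free programs -/

/-- Absence of loops. -/
def Prog.loopFree : Prog → Bool
  | .seq P Q => P.loopFree && Q.loopFree
  | .ite _ P Q => P.loopFree && Q.loopFree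
  | .loop _ _ => false
  | _ => true

open Classical in
/-- The effect of a loop-free program; loops are given the junk value `id`. -/
def Prog.run : Prog → State → State
  | .skip, s => s
  | .setNat x e, s => s.setNat x (e.eval s)
  | .setReal x e, s => s.setReal x (e.eval s)
  | .storeNat a k e, s => s.storeNat a (k.eval s) (e.eval s)
  | .storeReal a k e, s => s.storeReal a (k.eval s) (e.eval s)
  | .seq P Q, s => Q.run (P.run s)
  | .ite b P Q, s => if b.Holds s then P.run s else Q.run s
  | .loop _ _, s => s

/-- A bound for the running time of a loop-free program on every input. -/
def Prog.bound : Prog → ℕ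
  | .skip => 1
  | .setNat _ e => e.cost + 1
  | .setReal _ e => e.cost + 1
  | .storeNat _ k e => k.cost + e.cost + 1
  | .storeReal _ k e => k.cost + e.cost + 1
  | .seq P Q => P.bound + Q.bound
  | .ite b P Q => b.cost + 1 + (P.bound + Q.bound)
  | .loop _ _ => 0

theorem Prog.exec_run (P : Prog) (h : P.loopFree = true) (s : State) :
    ∃ t ≤ P.bound, Exec P s (P.run s) t := by
  induction P generalizing s with
  | skip => exact ⟨_, le_rfl, .skip s⟩
  | setNat x e => exact ⟨_, le_rfl, .setNat s x e⟩
  | setReal x e => exact ⟨_, le_rfl, .setReal s x e⟩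
  | storeNat a k e => exact ⟨_, le_rfl, .storeNat s a k e⟩
  | storeReal a k e => exact ⟨_, le_rfl, .storeReal s a k e⟩
  | seq P Q ihP ihQ =>
    simp only [loopFree, Bool.and_eq_true] at h
    obtain ⟨t, ht, he⟩ := ihP h.1 s
    obtain ⟨t', ht', he'⟩ := ihQ h.2 (P.run s)
    exact ⟨t + t', by simp only [bound]; omega, .seq he he'⟩
  | ite b P Q ihP ihQ =>
    simp only [loopFree, Bool.and_eq_true] at h
    by_cases hb : b.Holds s
    · obtain ⟨t, ht, he⟩ := ihP h.1 s
      refine ⟨_, ?_, by simpa [run, hb] using Exec.iteTrue (Q := Q) hb he⟩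
      simp only [bound]; omega
    · obtain ⟨t, ht, he⟩ := ihQ h.2 s
      refine ⟨_, ?_, by simpa [run, hb] using Exec.iteFalse (P := P) hb he⟩
      simp only [bound]; omega
  | loop b P => simp [loopFree] at h

theorem Runs.of_run {P : Prog} {s : State} {Q : State → Prop} (h : P.loopFree = true)
    (hQ : Q (P.run s)) : Runs P s P.bound Q := by
  obtain ⟨t, ht, he⟩ := P.exec_run h s
  exact ⟨_, t, he, ht, hQ⟩

theorem Runs.step {P P' : Prog} {s : State} {T : ℕ} {Q : State → Prop} (h : P.loopFree = true)
    (hQ : Runs P' (P.run s) T Q) : Runs (.seq P P') s (P.bound + T) Q :=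
  Runs.seq (Runs.of_run h hQ)

/-! ### Counting loops -/

/-- The test `e < f` on natural numbers. -/
abbrev Test.natLT (e f : NExp) : Test := .neg (.natLE f e)

/-- `for c := 0, …, N - 1 do body`, where the bound `N` is reevaluated before each round. -/
def Prog.forLoop (c : ℕ) (N : NExp) (body : Prog) : Prog :=
  .seq (.setNat c (.const 0))
    (.loop (.natLT (.reg c) N) (.seq body (.setNat c (.add (.reg c) (.const 1)))))

/-- The invariant `I k` describes the configuration before round `k`. -/
theorem Runs.forLoop {c : ℕ} {bd : NExp} {body : Prog} {s₀ : State} {N T : ℕ}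
    (I : ℕ → State → Prop) (hc : c ∉ body.natRegs)
    (hN : ∀ s, Frame (.forLoop c bd body) s₀ s → bd.eval s = N)
    (h₀ : I 0 (s₀.setNat c 0))
    (hstep : ∀ k < N, ∀ s, Frame (.forLoop c bd body) s₀ s → s.nat c = k → I k s →
      Runs body s T fun s' => I (k + 1) (s'.setNat c (k + 1))) :
    Runs (.forLoop c bd body) s₀ ((N + 1) * (T + bd.cost + 10)) (I N) := by
  have hF0 : Frame (.forLoop c bd body) s₀ (s₀.setNat c 0) := by
    constructor <;> simp +contextual [Prog.forLoop, Prog.natRegs]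
  have hsub : ∀ {s}, Frame (.seq body (.setNat c (.add (.reg c) (.const 1)))) (s₀.setNat c 0) s →
      Frame (.forLoop c bd body) s₀ s := fun h =>
    hF0.trans (h.mono (by simp [Prog.forLoop, Prog.natRegs]) (by simp [Prog.forLoop, Prog.realRegs])
      (by simp [Prog.forLoop, Prog.natArrs]) (by simp [Prog.forLoop, Prog.realArrs]))
  have h1 := Runs.loop (b := .natLT (.reg c) bd)
    (P := .seq body (.setNat c (.add (.reg c) (.const 1)))) (s₀ := s₀.setNat c 0) (N := N)
    (T := T + 4) (fun k s => s.nat c = k ∧ I k s) ⟨by simp, h₀⟩ ?_ ?_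
  · refine (Runs.step (P := .setNat c (.const 0)) rfl h1).mono ?_ fun s' _ h => h.2
    simp only [Test.cost, NExp.cost, Prog.bound]; nlinarith
  · rintro k hk s hF ⟨hs, hI⟩
    refine ⟨by simp [Test.Holds, NExp.eval, hs, hN s (hsub hF), hk], ?_⟩
    refine Runs.seq ((hstep k hk s (hsub hF) hs hI).mono le_rfl fun s' hF' hI' => ?_)
    have : s'.nat c = k := by rw [hF'.nat c hc, hs]
    exact ⟨_, _, .setNat _ _ _, by simp [NExp.cost], by simp [NExp.eval, this],
      by simpa [NExp.eval, this] using hI'⟩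
  · rintro s hF ⟨hs, -⟩
    simp [Test.Holds, NExp.eval, hs, hN s (hsub hF)]

/-! ### Trees of functions -/

/-- In the complete binary tree with `2 ^ h` leaves whose nodes are numbered as in a heap, every
node `v` carries the function `f (tree v)`. All functions on the path from the root to the `x`-th
leaf, which is the node `2 ^ h + x`, are at most `b` at `x`. -/
def PathLE (f : ℕ → ℕ → ℝ) (h : ℕ) (tree : ℕ → ℕ) (x : ℕ) (b : ℝ) : Prop :=
  ∀ e ≤ h, f (tree ((2 ^ h + x) / 2 ^ e)) x ≤ b

theorem div_two_pow_eq_iff {h v w lo x : ℕ} (hw : 0 < w) (hv : v * w = 2 ^ h + lo) :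
    (2 ^ h + x) / w = v ↔ lo ≤ x ∧ x < lo + w := by
  rw [Nat.div_eq_iff hw]
  omega

theorem level_unique {h e e' x y : ℕ} (hx : x < 2 ^ h) (hy : y < 2 ^ h) (he : e ≤ h) (he' : e' ≤ h)
    (heq : (2 ^ h + x) / 2 ^ e = (2 ^ h + y) / 2 ^ e') : e = e' := by
  have key : ∀ {z e}, z < 2 ^ h → e ≤ h → Nat.log 2 ((2 ^ h + z) / 2 ^ e) = h - e := by
    intro z e hz he
    have hpow : 2 ^ (h - e) * 2 ^ e = 2 ^ h := by rw [← pow_add, Nat.sub_add_cancel he]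
    refine Nat.log_eq_of_pow_le_of_lt_pow ?_ ?_
    · rw [Nat.le_div_iff_mul_le (by positivity), hpow]; omega
    · rw [Nat.div_lt_iff_lt_mul (by positivity), pow_succ, mul_right_comm, hpow]; omega
  have h1 := key hx he
  have h2 := key hy he'
  rw [heq] at h1
  omega

/-- Exchanging the function at the node `v` with a pending function, that is still to be entered
below `v`, does not change the bounds. -/
theorem pathLE_exchange {f : ℕ → ℕ → ℝ} {h e v lo x cur W L : ℕ} {tree tree' : ℕ → ℕ} {b : ℝ}
    (he : e ≤ h) (hv : v * 2 ^ e = 2 ^ h + lo) (hlo : lo + 2 ^ e ≤ 2 ^ h) (hx : x < 2 ^ h)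
    (htree : tree' = Function.update tree v W)
    (hWL : (W = tree v ∧ L = cur) ∨ (W = cur ∧ L = tree v)) :
    (PathLE f h tree x b ∧ (lo ≤ x → x < lo + 2 ^ e → f cur x ≤ b)) ↔
      (PathLE f h tree' x b ∧ (lo ≤ x → x < lo + 2 ^ e → f L x ≤ b)) := by
  have hpos : 0 < 2 ^ e := by positivity
  have hr := div_two_pow_eq_iff (x := x) hpos hv
  have hv' : (2 ^ h + lo) / 2 ^ e = v := by rw [← hv]; exact Nat.mul_div_cancel _ hpos
  have hne : ∀ e' ≤ h, e' ≠ e → (2 ^ h + x) / 2 ^ e' ≠ v := fun e' he' hee heq =>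
    hee (level_unique hx (by omega) he' he (heq.trans hv'.symm))
  by_cases hin : lo ≤ x ∧ x < lo + 2 ^ e
  · have hxv := hr.2 hin
    have split : ∀ tr : ℕ → ℕ, PathLE f h tr x b ↔
        (∀ e' ≤ h, e' ≠ e → f (tr ((2 ^ h + x) / 2 ^ e')) x ≤ b) ∧ f (tr v) x ≤ b := by
      intro tr
      refine ⟨fun H => ⟨fun e' he' _ => H e' he', hxv ▸ H e he⟩, fun H e' he' => ?_⟩
      by_cases hee : e' = e
      · rw [hee, hxv]; exact H.2
      · exact H.1 e' he' hee
    have hrest : (∀ e' ≤ h, e' ≠ e → f (tree' ((2 ^ h + x) / 2 ^ e')) x ≤ b) ↔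
        (∀ e' ≤ h, e' ≠ e → f (tree ((2 ^ h + x) / 2 ^ e')) x ≤ b) := by
      refine forall₃_congr fun e' he' hee => ?_
      rw [htree, Function.update_of_ne (hne e' he' hee)]
    have htv : tree' v = W := by simp [htree]
    rw [split tree, split tree', hrest, htv]
    simp only [hin.1, hin.2, true_imp_iff]
    rcases hWL with ⟨rfl, rfl⟩ | ⟨rfl, rfl⟩ <;> tauto
  · have h1 : PathLE f h tree' x b ↔ PathLE f h tree x b := by
      refine forall₂_congr fun e' he' => ?_
      rw [htree, Function.update_of_ne]
      by_cases hee : e' = e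
      · rw [hee]; exact fun h' => hin (hr.1 h')
      · exact hne e' he' hee
    rw [h1]
    tauto

/-- A family of real functions, as program text: `val k x` is the value of the function with
number `k` at the position `x`; if the function number `l` is at most the function number `w` at
the position `m`, then the test `left l w m` decides on which side of `m` it can still be larger. -/
structure Family where
  val : NExp → NExp → RExp
  left : NExp → NExp → NExp → Test

/-- The expressions and tests of the family have the meanings `f` and `lf` in `s`, and in all
configurations that agree with `s` on the natural-number array `1` and on the real arrays other
than `2`. -/
def Family.Denotes (F : Family) (s : State) (f : ℕ → ℕ → ℝ) (lf : ℕ → ℕ → ℕ → Prop) : Prop :=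
  ∀ s', (∀ a, a ≠ 2 → s'.realArr a = s.realArr a) → s'.natArr 1 = s.natArr 1 →
    (∀ k x, (F.val k x).eval s' = f (k.eval s') (x.eval s')) ∧
    (∀ l w m, (F.left l w m).Holds s' ↔ lf (l.eval s') (w.eval s') (m.eval s'))

/-- Two functions of the family exchange their order at most once on `{0, …, M - 1}`, and `lf`
tells on which side. -/
def SingleCrossing (f : ℕ → ℕ → ℝ) (lf : ℕ → ℕ → ℕ → Prop) (M : ℕ) : Prop :=
  ∀ l w m, m < M → f l m ≤ f w m →
    (lf l w m → ∀ z, m ≤ z → z < M → f l z ≤ f w z) ∧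
    (¬ lf l w m → ∀ x, x < m → f l x ≤ f w x)

/-- The node `nat 11` is responsible for the positions from `nat 12` to `nat 12 + nat 13 - 1`; load
its middle position and its function. -/
def insertLoad (t : ℕ) : Prog :=
  .seq (.setNat 16 (.half (.reg 13))) <|
  .seq (.setNat 14 (.add (.reg 12) (.reg 16))) (.setNat 15 (.cell t (.reg 11)))

/-- The function that is larger in the middle stays at the node. -/
def insertSwap (t : ℕ) (F : Family) : Prog :=
  .ite (.realLE (F.val (.reg 10) (.reg 14)) (F.val (.reg 15) (.reg 14))) .skip
    (.seq (.storeNat t (.reg 11) (.reg 10)) <|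
     .seq (.setNat 17 (.reg 10)) <| .seq (.setNat 10 (.reg 15)) (.setNat 15 (.reg 17)))

/-- The other function moves on to a child. -/
def insertMove (F : Family) : Prog :=
  .seq (.ite (F.left (.reg 10) (.reg 15) (.reg 14)) (.setNat 11 (.add (.reg 11) (.reg 11)))
    (.seq (.setNat 11 (.add (.add (.reg 11) (.reg 11)) (.const 1))) (.setNat 12 (.reg 14)))) <|
  .setNat 13 (.reg 16)

/-- One step of the descent. -/
def insertBody (t : ℕ) (F : Family) : Prog :=
  .seq (insertLoad t) (.seq (insertSwap t F) (insertMove F))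

/-- Insertion of the function with number `nat 10` into the tree stored in the array `t`. The
number of leaves is `nat 1`. -/
def insertProg (t : ℕ) (F : Family) : Prog :=
  .seq (.setNat 11 (.const 1)) <| .seq (.setNat 12 (.const 0)) <| .seq (.setNat 13 (.reg 1)) <|
  .loop (.neg (.natLE (.reg 13) (.const 0))) (insertBody t F)

/-- The situation before the `k`-th step of the descent that inserts the function `c₀`. -/
structure InsertInv (f : ℕ → ℕ → ℝ) (h : ℕ) (tree₀ : ℕ → ℕ) (c₀ k : ℕ)
    (tree : ℕ → ℕ) (cur v lo w : ℕ) : Prop where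
  width : k ≤ h → w = 2 ^ (h - k) ∧ v * 2 ^ (h - k) = 2 ^ h + lo ∧ lo + w ≤ 2 ^ h
  done : k = h + 1 → w = 0
  bounds : ∀ x < 2 ^ h, ∀ b : ℝ, (PathLE f h tree x b ∧ (lo ≤ x → x < lo + w → f cur x ≤ b)) ↔
    (PathLE f h tree₀ x b ∧ f c₀ x ≤ b)

theorem InsertInv.step {f : ℕ → ℕ → ℝ} {lf : ℕ → ℕ → ℕ → Prop} {h : ℕ} {tree₀ : ℕ → ℕ}
    {c₀ k : ℕ} {tree : ℕ → ℕ} {cur v lo w W L v' lo' : ℕ} (hk : k ≤ h)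
    (hsc : SingleCrossing f lf (2 ^ h)) (H : InsertInv f h tree₀ c₀ k tree cur v lo w)
    (hWL : (W = tree v ∧ L = cur) ∨ (W = cur ∧ L = tree v))
    (hle : f L (lo + w / 2) ≤ f W (lo + w / 2))
    (hdir : (lf L W (lo + w / 2) ∧ v' = v + v ∧ lo' = lo) ∨
      (¬ lf L W (lo + w / 2) ∧ v' = v + v + 1 ∧ lo' = lo + w / 2)) :
    InsertInv f h tree₀ c₀ (k + 1) (Function.update tree v W) L v' lo' (w / 2) := by
  obtain ⟨rfl, hv, hlo⟩ := H.width hk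
  have hmid : lo + 2 ^ (h - k) / 2 < 2 ^ h := by
    have : 2 ^ (h - k) / 2 < 2 ^ (h - k) := Nat.div_lt_self (by positivity) (by norm_num)
    omega
  refine ⟨fun hk' => ?_, fun hk' => ?_, fun x hx b => ?_⟩
  · obtain ⟨d, hd⟩ : ∃ d, h - k = d + 1 := ⟨h - k - 1, by omega⟩
    have hd' : h - (k + 1) = d := by omega
    rw [hd, pow_succ] at hv hlo hdir
    rw [hd, hd', pow_succ, Nat.mul_div_cancel _ (by norm_num)]
    rw [Nat.mul_div_cancel _ (by norm_num)] at hdir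
    refine ⟨rfl, ?_⟩
    rcases hdir with ⟨-, rfl, rfl⟩ | ⟨-, rfl, rfl⟩
    · exact ⟨by linarith, by omega⟩
    · exact ⟨by linarith, by omega⟩
  · obtain rfl : k = h := by omega
    simp
  · rw [← H.bounds x hx b, pathLE_exchange (by omega) hv hlo hx rfl hWL]
    obtain ⟨hl, hr⟩ := hsc L W _ hmid hle
    have hdbl : 2 ^ (h - k) / 2 + 2 ^ (h - k) / 2 ≤ 2 ^ (h - k) := by omega
    -- In the range of the node, the function kept there bounds the other one on the far side.
    have hWb : PathLE f h (Function.update tree v W) x b → lo ≤ x → x < lo + 2 ^ (h - k) →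
        f W x ≤ b := by
      intro hp h1 h2
      have := hp (h - k) (by omega)
      rwa [(div_two_pow_eq_iff (by positivity) hv).2 ⟨h1, h2⟩, Function.update_self] at this
    constructor
    · rintro ⟨hp, hb⟩
      refine ⟨hp, fun h1 h2 => ?_⟩
      rcases hdir with ⟨hd, rfl, rfl⟩ | ⟨hd, rfl, rfl⟩
      · by_cases hx' : x < lo' + 2 ^ (h - k) / 2
        · exact hb h1 hx'
        · exact (hl hd x (by omega) hx).trans (hWb hp h1 h2)
      · by_cases hx' : x < lo + 2 ^ (h - k) / 2
        · exact (hr hd x hx').trans (hWb hp h1 h2)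
        · by_cases hx'' : x < lo + 2 ^ (h - k) / 2 + 2 ^ (h - k) / 2
          · exact hb (by omega) hx''
          · -- Only a leaf, whose width is odd, leaves a position beyond both halves.
            have hxm : x = lo + 2 ^ (h - k) / 2 := by
              rcases Nat.eq_zero_or_pos (h - k) with h0 | h0
              · rw [h0] at h2 hx' ⊢; omega
              · obtain ⟨d, hd⟩ : ∃ d, h - k = d + 1 := ⟨h - k - 1, by omega⟩
                rw [hd, pow_succ] at h2 hx''; omega
            rw [hxm] at hWb ⊢
            exact hle.trans (hWb (hxm ▸ hp) (hxm ▸ h1) (hxm ▸ h2))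
    · rintro ⟨hp, hb⟩
      refine ⟨hp, fun h1 h2 => ?_⟩
      rcases hdir with ⟨hd, rfl, rfl⟩ | ⟨hd, rfl, rfl⟩
      · exact hb h1 (by omega)
      · exact hb (by omega) (by omega)

/-! ### Insertion and queries -/

theorem insertProg_runs (t : ℕ) (ht : t ≠ 1) (F : Family) : ∃ K, ∀ (h : ℕ) (s : State)
    (f : ℕ → ℕ → ℝ) (lf : ℕ → ℕ → ℕ → Prop), s.nat 1 = 2 ^ h → F.Denotes s f lf →
    SingleCrossing f lf (2 ^ h) →
    Runs (insertProg t F) s (K * (h + 1)) fun s' => ∀ x < 2 ^ h, ∀ b : ℝ,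
      PathLE f h (s'.natArr t) x b ↔ PathLE f h (s.natArr t) x b ∧ f (s.nat 10) x ≤ b := by
  refine ⟨(insertBody t F).bound + 20, fun h s f lf hM hD hsc => ?_⟩
  have hloop := Runs.loop (b := .neg (.natLE (.reg 13) (.const 0))) (P := insertBody t F)
    (s₀ := ((s.setNat 11 1).setNat 12 0).setNat 13 (s.nat 1)) (N := h + 1)
    (T := (insertBody t F).bound)
    (fun k s' => InsertInv f h (s.natArr t) (s.nat 10) k (s'.natArr t) (s'.nat 10) (s'.nat 11)
      (s'.nat 12) (s'.nat 13)) ?_ ?_ ?_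
  · refine Runs.mono (Runs.step (P := .setNat 11 (.const 1)) rfl <|
      Runs.step (P := .setNat 12 (.const 0)) rfl <|
      Runs.step (P := .setNat 13 (.reg 1)) rfl (by simpa [Prog.run, NExp.eval] using hloop)) ?_ ?_
    · simp only [Prog.bound, NExp.cost, Test.cost]; nlinarith
    · intro s' _ H x hx b
      rw [← H.bounds x hx b, H.done rfl]
      exact ⟨fun h' => ⟨h', fun _ _ => by omega⟩, fun h' => h'.1⟩
  · refine ⟨fun _ => by simp [hM], by simp, fun x hx b => ?_⟩
    simp [hM, hx]
  · intro k hk s' hF hI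
    have hreal : ∀ a, s'.realArr a = s.realArr a := fun a => hF.realArr a (by simp [insertBody,
      insertLoad, insertSwap, insertMove, Prog.realArrs])
    have hidx : s'.natArr 1 = s.natArr 1 := hF.natArr 1 (by simp [insertBody,
      insertLoad, insertSwap, insertMove, Prog.natArrs, ht.symm])
    refine ⟨?_, Runs.of_run rfl ?_⟩
    · have := (hI.width (by omega)).1
      simp [Test.Holds, NExp.eval, this]
    · show InsertInv f h (s.natArr t) (s.nat 10) (k + 1) _ _ _ _ _
      have e1 : (insertBody t F).run s' =
        (insertMove F).run ((insertSwap t F).run ((insertLoad t).run s')) := rfl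
      rw [e1]
      obtain ⟨s1, hs1⟩ : ∃ s1, s1 = (insertLoad t).run s' := ⟨_, rfl⟩
      rw [← hs1]
      have a10 : s1.nat 10 = s'.nat 10 := by simp [hs1, insertLoad, Prog.run]
      have a11 : s1.nat 11 = s'.nat 11 := by simp [hs1, insertLoad, Prog.run]
      have a12 : s1.nat 12 = s'.nat 12 := by simp [hs1, insertLoad, Prog.run]
      have a14 : s1.nat 14 = s'.nat 12 + s'.nat 13 / 2 := by
        simp [hs1, insertLoad, Prog.run, NExp.eval]
      have a15 : s1.nat 15 = s'.natArr t (s'.nat 11) := by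
        simp [hs1, insertLoad, Prog.run, NExp.eval]
      have a16 : s1.nat 16 = s'.nat 13 / 2 := by simp [hs1, insertLoad, Prog.run, NExp.eval]
      have aN : s1.natArr = s'.natArr := by simp [hs1, insertLoad, Prog.run]
      have aR : s1.realArr = s'.realArr := by simp [hs1, insertLoad, Prog.run]
      have hD1 := hD s1 (fun a _ => by rw [aR, hreal]) (by rw [aN, hidx])
      obtain ⟨s2, hs2⟩ : ∃ s2, s2 = (insertSwap t F).run s1 := ⟨_, rfl⟩
      rw [← hs2]
      have key : ∃ W L, ((W = s'.natArr t (s'.nat 11) ∧ L = s'.nat 10) ∨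
          (W = s'.nat 10 ∧ L = s'.natArr t (s'.nat 11))) ∧
          f L (s'.nat 12 + s'.nat 13 / 2) ≤ f W (s'.nat 12 + s'.nat 13 / 2) ∧
          s2.natArr t = Function.update (s'.natArr t) (s'.nat 11) W ∧ s2.nat 10 = L ∧
          s2.nat 15 = W ∧ s2.nat 11 = s'.nat 11 ∧ s2.nat 12 = s'.nat 12 ∧
          s2.nat 14 = s'.nat 12 + s'.nat 13 / 2 ∧ s2.nat 16 = s'.nat 13 / 2 ∧
          s2.natArr 1 = s'.natArr 1 ∧ s2.realArr = s'.realArr := by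
        by_cases hc : f (s'.nat 10) (s'.nat 12 + s'.nat 13 / 2) ≤
            f (s'.natArr t (s'.nat 11)) (s'.nat 12 + s'.nat 13 / 2)
        · have : s2 = s1 := by
            simp [hs2, insertSwap, Prog.run, Test.Holds, hD1.1, NExp.eval, a10, a14, a15, hc]
          refine ⟨_, _, Or.inl ⟨rfl, rfl⟩, hc, ?_⟩
          simp [this, a10, a11, a12, a14, a15, a16, aN, aR]
        · have : s2 = (insertSwap t F).run s1 := hs2
          simp only [insertSwap, Prog.run, Test.Holds, hD1.1, NExp.eval, a10, a14, a15, hc,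
            if_false] at this
          refine ⟨_, _, Or.inr ⟨rfl, rfl⟩, (not_le.1 hc).le, ?_⟩
          simp [this, a10, a11, a12, a14, a15, a16, aN, aR, ht.symm]
      obtain ⟨W, L, hWL, hle, b1, b10, b15, b11, b12, b14, b16, bN, bR⟩ := key
      have hD2 := hD s2 (fun a _ => by rw [bR, hreal]) (by rw [bN, hidx])
      by_cases hl : lf L W (s'.nat 12 + s'.nat 13 / 2)
      · have := hI.step (v' := s'.nat 11 + s'.nat 11) (lo' := s'.nat 12) (by omega) hsc hWL hle
          (Or.inl ⟨hl, rfl, rfl⟩)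
        simpa [insertMove, Prog.run, Test.Holds, hD2.2, NExp.eval, hl, b1, b10, b15, b11, b12, b14,
          b16] using this
      · have := hI.step (v' := s'.nat 11 + s'.nat 11 + 1)
          (lo' := s'.nat 12 + s'.nat 13 / 2) (by omega) hsc hWL hle
          (Or.inr ⟨hl, rfl, rfl⟩)
        simpa [insertMove, Prog.run, Test.Holds, hD2.2, NExp.eval, hl, b1, b10, b15, b11, b12, b14,
          b16] using this
  · intro s' _ hI
    simp [Test.Holds, NExp.eval, hI.done rfl]

/-- One step of a query: take the function at the node `nat 18` into account and move on to the
parent. -/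
def queryBody (t : ℕ) (F : Family) : Prog :=
  .seq (.ite (.realLE (F.val (.cell t (.reg 18)) (.reg 19)) (.reg 0)) .skip
    (.setReal 0 (F.val (.cell t (.reg 18)) (.reg 19)))) <|
  .setNat 18 (.half (.reg 18))

/-- The maximum of `0` and of the functions in the tree `t` at the position `nat 19` is stored in
the real register `0`. -/
def queryProg (t : ℕ) (F : Family) : Prog :=
  .seq (.setReal 0 (.const 0)) <| .seq (.setNat 18 (.add (.reg 1) (.reg 19))) <|
  .loop (.natLT (.const 0) (.reg 18)) (queryBody t F)

theorem queryProg_runs (t : ℕ) (F : Family) : ∃ K, ∀ (h : ℕ) (s : State)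
    (f : ℕ → ℕ → ℝ) (lf : ℕ → ℕ → ℕ → Prop), s.nat 1 = 2 ^ h → F.Denotes s f lf →
    s.nat 19 < 2 ^ h →
    Runs (queryProg t F) s (K * (h + 1)) fun s' => ∀ b : ℝ,
      s'.real 0 ≤ b ↔ 0 ≤ b ∧ PathLE f h (s.natArr t) (s.nat 19) b := by
  refine ⟨(queryBody t F).bound + 20, fun h s f lf hM hD hx => ?_⟩
  have hloop := Runs.loop (b := .natLT (.const 0) (.reg 18)) (P := queryBody t F)
    (s₀ := ((s.setReal 0 0).setNat 18 (s.nat 1 + s.nat 19))) (N := h + 1)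
    (T := (queryBody t F).bound)
    (fun k s' => s'.nat 18 = (2 ^ h + s.nat 19) / 2 ^ k ∧ ∀ b : ℝ, s'.real 0 ≤ b ↔ 0 ≤ b ∧
      ∀ e < k, f (s.natArr t ((2 ^ h + s.nat 19) / 2 ^ e)) (s.nat 19) ≤ b) ?_ ?_ ?_
  · refine Runs.mono (Runs.step (P := .setReal 0 (.const 0)) rfl <|
      Runs.step (P := .setNat 18 (.add (.reg 1) (.reg 19))) rfl
        (by simpa [Prog.run, NExp.eval, RExp.eval] using hloop)) ?_ ?_
    · simp only [Prog.bound, NExp.cost, RExp.cost, Test.cost]; nlinarith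
    · intro s' _ H b
      rw [H.2 b, PathLE]
  · simp [hM]
  · rintro k hk s' hF ⟨hv, hI⟩
    have hreal : ∀ a, s'.realArr a = s.realArr a := fun a => hF.realArr a (by simp [queryBody,
      Prog.realArrs])
    have hnat : ∀ a, s'.natArr a = s.natArr a := fun a => hF.natArr a (by simp [queryBody,
      Prog.natArrs])
    have h19 : s'.nat 19 = s.nat 19 := hF.nat 19 (by simp [queryBody, Prog.natRegs])
    have hD1 := (hD s' (fun a _ => hreal a) (hnat 1)).1
    have hpos : 0 < s'.nat 18 := by
      rw [hv]
      refine Nat.div_pos (le_trans (Nat.pow_le_pow_right (by norm_num) (by omega))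
        (Nat.le_add_right _ _)) (by positivity)
    refine ⟨by simp [Test.Holds, NExp.eval]; omega, Runs.of_run rfl ?_⟩
    have hhalf : (2 ^ h + s.nat 19) / 2 ^ k / 2 = (2 ^ h + s.nat 19) / 2 ^ (k + 1) := by
      rw [Nat.div_div_eq_div_mul, pow_succ]
    have hsplit : ∀ p : ℕ → Prop, (∀ e < k + 1, p e) ↔ (∀ e < k, p e) ∧ p k := fun p =>
      ⟨fun H => ⟨fun e he => H e (by omega), H k (by omega)⟩, fun H e he => by
        rcases Nat.lt_succ_iff_lt_or_eq.1 he with h' | rfl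
        exacts [H.1 e h', H.2]⟩
    by_cases hc : f (s.natArr t ((2 ^ h + s.nat 19) / 2 ^ k)) (s.nat 19) ≤ s'.real 0
    · have : (queryBody t F).run s' = s'.setNat 18 (s'.nat 18 / 2) := by
        simp [queryBody, Prog.run, Test.Holds, hD1, NExp.eval, RExp.eval, hnat, h19, hv, hc]
      rw [this]
      refine ⟨by simp [hv, hhalf], fun b => ?_⟩
      rw [hsplit]
      simp only [setNat_real]
      rw [hI b]
      exact ⟨fun h' => ⟨h'.1, h'.2, hc.trans ((hI b).2 h')⟩, fun h' => ⟨h'.1, h'.2.1⟩⟩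
    · have : (queryBody t F).run s' = (s'.setReal 0
          (f (s.natArr t ((2 ^ h + s.nat 19) / 2 ^ k)) (s.nat 19))).setNat 18 (s'.nat 18 / 2) := by
        simp [queryBody, Prog.run, Test.Holds, hD1, NExp.eval, RExp.eval, hnat, h19, hv, hc]
      rw [this]
      refine ⟨by simp [hv, hhalf], fun b => ?_⟩
      rw [hsplit]
      simp only [setNat_real, setReal_real, if_true]
      refine ⟨fun h' => ?_, fun h' => h'.2.2⟩
      have := (hI b).1 ((not_le.1 hc).le.trans h')
      exact ⟨this.1, this.2, h'⟩
  · rintro s' _ ⟨hv, -⟩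
    have : (2 ^ h + s.nat 19) / 2 ^ (h + 1) = 0 := Nat.div_eq_of_lt (by rw [pow_succ]; omega)
    simp [Test.Holds, NExp.eval, hv, this]

/-! ### Merge sort -/

section MergeSort

/-- The blocks of `w` consecutive cells of `A` are sorted, below `M`. -/
def BlocksSorted (r : ℕ → ℕ → Prop) (w M : ℕ) (A : ℕ → ℕ) : Prop :=
  ∀ x y, x ≤ y → y < M → x / w = y / w → r (A x) (A y)

/-- The situation while the blocks of width `w` of `A` are merged in pairs into `B`: the cells of
`B` below `o` are written, the current pair of blocks occupies the cells from `st` to `e - 1` and is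
divided at `l`, and its cells from `a` to `l - 1` and from `b` to `e - 1` are still to be moved. -/
structure MergeInv (r : ℕ → ℕ → Prop) (w M : ℕ) (A B : ℕ → ℕ) (st o a b l e : ℕ) : Prop where
  st_dvd : 2 * w ∣ st
  e_dvd : 2 * w ∣ e
  l_dvd : w ∣ l
  st_le : st ≤ a
  a_le : a ≤ l
  l_le : l ≤ b
  b_le : b ≤ e
  e_le : e ≤ M
  left_len : l ≤ st + w
  right_len : e ≤ l + w
  count : a + b = o + l
  cover : ∀ x, (x < a ∨ (l ≤ x ∧ x < b)) → ∃ y < o, B y = A x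
  range : ∀ y < o, B y < M
  sorted : ∀ x y, x ≤ y → y < o → x / (2 * w) = y / (2 * w) → r (B x) (B y)
  dom : ∀ y, st ≤ y → y < o → ∀ x, ((a ≤ x ∧ x < l) ∨ (b ≤ x ∧ x < e)) → r (B y) (A x)

variable {r : ℕ → ℕ → Prop} {w M : ℕ} {A B : ℕ → ℕ} {st o a b l e : ℕ}

theorem MergeInv.reset (H : MergeInv r w M A B st o a b l e) (hM : 2 * w ∣ M)
    (ho : o < M) (he : e ≤ o) :
    MergeInv r w M A B o o o (o + w) (o + w) (o + w + w) := by
  obtain ⟨h1, h2, h3, h4, h5, h6, h7, h8, h9, h10, h11, h12, h13, h14, h15⟩ := H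
  obtain rfl : o = e := by omega
  have hwo : w ∣ o := (Dvd.intro_left 2 rfl).trans h2
  refine ⟨h2, ?_, (Nat.dvd_add_right hwo).2 dvd_rfl, le_rfl, by omega, le_rfl, by omega, ?_, le_rfl,
    le_rfl, by omega, fun x hx => h12 x (by omega), h13, h14, fun y _ _ => by omega⟩
  · rw [add_assoc, ← two_mul]; exact (Nat.dvd_add_right h2).2 dvd_rfl
  · obtain ⟨p, rfl⟩ := h2
    obtain ⟨q, rfl⟩ := hM
    have : p < q := lt_of_mul_lt_mul_left ho (Nat.zero_le _)
    nlinarith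

theorem MergeInv.block_eq (H : MergeInv r w M A B st o a b l e) (hw : 0 < w) {x : ℕ}
    (hx : x / (2 * w) = o / (2 * w)) : st ≤ x := by
  obtain ⟨p, hp⟩ := H.st_dvd
  have hso : st ≤ o := by have := H.count; have := H.st_le; have := H.l_le; omega
  have : p ≤ o / (2 * w) := by rw [Nat.le_div_iff_mul_le (by omega)]; linarith
  rw [← hx, Nat.le_div_iff_mul_le (by omega)] at this
  linarith

theorem MergeInv.left_sorted (H : MergeInv r w M A B st o a b l e) (hw : 0 < w)
    (hA : BlocksSorted r w M A) {x y : ℕ} (hx : a ≤ x) (hxy : x ≤ y) (hy : y < l) :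
    r (A x) (A y) := by
  obtain ⟨h1, h2, h3, h4, h5, h6, h7, h8, h9, h10, h11, h12, h13, h14, h15⟩ := H
  refine hA x y hxy (by omega) ?_
  obtain ⟨p, rfl⟩ := h1
  have : ∀ z, 2 * w * p ≤ z → z < 2 * w * p + w → z / w = 2 * p := fun z h1 h2 => by
    rw [Nat.div_eq_iff hw]
    have : 2 * p * w = 2 * w * p := by ring
    omega
  rw [this x (by omega) (by omega), this y (by omega) (by omega)]

theorem MergeInv.right_sorted (H : MergeInv r w M A B st o a b l e) (hw : 0 < w)
    (hA : BlocksSorted r w M A) {x y : ℕ} (hx : b ≤ x) (hxy : x ≤ y) (hy : y < e) :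
    r (A x) (A y) := by
  obtain ⟨h1, h2, h3, h4, h5, h6, h7, h8, h9, h10, h11, h12, h13, h14, h15⟩ := H
  refine hA x y hxy (by omega) ?_
  obtain ⟨p, rfl⟩ := h3
  have : ∀ z, w * p ≤ z → z < w * p + w → z / w = p := fun z h1 h2 => by
    rw [Nat.div_eq_iff hw]
    have : p * w = w * p := by ring
    omega
  rw [this x (by omega) (by omega), this y (by omega) (by omega)]

/-- Moving the next cell `z` of one of the two blocks, provided that it is a smallest of the
remaining ones. -/
theorem MergeInv.take (H : MergeInv r w M A B st o a b l e) (hw : 0 < w) (hA : ∀ x < M, A x < M)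
    (hr : ∀ c < M, r c c)
    {z a' b' : ℕ} (hz : (z = a ∧ a < l ∧ a' = a + 1 ∧ b' = b) ∨
      (z = b ∧ b < e ∧ a' = a ∧ b' = b + 1))
    (hmin : ∀ x, ((a ≤ x ∧ x < l) ∨ (b ≤ x ∧ x < e)) → r (A z) (A x)) :
    MergeInv r w M A (Function.update B o (A z)) st (o + 1) a' b' l e := by
  have hblock := @MergeInv.block_eq _ _ _ _ _ _ _ _ _ _ _ H hw
  obtain ⟨h1, h2, h3, h4, h5, h6, h7, h8, h9, h10, h11, h12, h13, h14, h15⟩ := H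
  have hB : ∀ y < o, Function.update B o (A z) y = B y := fun y hy =>
    Function.update_of_ne (by omega) _ _
  refine ⟨h1, h2, h3, by omega, by omega, by omega, by omega, h8, h9, h10, by omega, ?_, ?_, ?_, ?_⟩
  · intro x hx
    by_cases hxz : x = z
    · exact ⟨o, by omega, by simp [hxz]⟩
    · obtain ⟨y, hy, hyx⟩ := h12 x (by omega)
      exact ⟨y, by omega, by rw [hB y hy, hyx]⟩
  · intro y hy
    rcases Nat.lt_succ_iff_lt_or_eq.1 hy with hy | rfl
    · rw [hB y hy]; exact h13 y hy
    · rw [Function.update_self]; exact hA _ (by omega)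
  · intro x y hxy hy hd
    rcases Nat.lt_succ_iff_lt_or_eq.1 hy with hy | rfl
    · rw [hB y hy, hB x (by omega)]; exact h14 x y hxy hy hd
    · rw [Function.update_self]
      rcases hxy.lt_or_eq with hxy | rfl
      · rw [hB x hxy]; exact h15 x (hblock hd) hxy z (by omega)
      · rw [Function.update_self]; exact hr _ (hA _ (by omega))
  · intro y hy1 hy2 x hx
    rcases Nat.lt_succ_iff_lt_or_eq.1 hy2 with hy | rfl
    · rw [hB y hy]; exact h15 y hy1 hy x (by omega)
    · rw [Function.update_self]; exact hmin x (by omega)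

/-- If a pair of blocks is complete, start with the next pair. -/
def mergeReset : Prog :=
  .ite (.natLE (.reg 9) (.reg 5))
    (.seq (.setNat 6 (.reg 5)) <| .seq (.setNat 8 (.add (.reg 5) (.reg 4))) <|
      .seq (.setNat 7 (.reg 8)) (.setNat 9 (.add (.reg 8) (.reg 4)))) .skip

/-- The next cell is to be taken from the left one of the two blocks. -/
def takeLeft (le : NExp → NExp → Test) : Test :=
  .conj (.natLT (.reg 6) (.reg 8))
    (.neg (.conj (.natLT (.reg 7) (.reg 9)) (.neg (le (.cell 1 (.reg 6)) (.cell 1 (.reg 7))))))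

/-- Move a smallest remaining cell of the current pair of blocks. -/
def mergeTake (le : NExp → NExp → Test) : Prog :=
  .ite (takeLeft le)
    (.seq (.storeNat 2 (.reg 5) (.cell 1 (.reg 6))) (.setNat 6 (.add (.reg 6) (.const 1))))
    (.seq (.storeNat 2 (.reg 5) (.cell 1 (.reg 7))) (.setNat 7 (.add (.reg 7) (.const 1))))

/-- Merge the blocks of width `nat 4` of the array `1` in pairs. -/
def mergePass (le : NExp → NExp → Test) : Prog :=
  .seq (.seq (.setNat 6 (.const 0)) <| .seq (.setNat 7 (.const 0)) <|
    .seq (.setNat 8 (.const 0)) (.setNat 9 (.const 0))) <|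
  .seq (.forLoop 5 (.reg 1) (.seq mergeReset (mergeTake le)))
    (.forLoop 5 (.reg 1) (.storeNat 1 (.reg 5) (.cell 2 (.reg 5))))

/-- Sort the first `nat 1` cells of the natural-number array `1`. -/
def sortProg (le : NExp → NExp → Test) : Prog :=
  .seq (.setNat 4 (.const 1)) <|
  .loop (.natLT (.reg 4) (.reg 1))
    (.seq (mergePass le) (.setNat 4 (.add (.reg 4) (.reg 4))))

/-- `le` has the meaning `r` in all configurations with the same real arrays as `s`. -/
def TestDenotes (le : NExp → NExp → Test) (s : State) (r : ℕ → ℕ → Prop) : Prop :=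
  ∀ s', s'.realArr = s.realArr → ∀ i j, (le i j).Holds s' ↔ r (i.eval s') (j.eval s')

/-- The first `M` cells of `A` contain exactly the numbers below `M`. -/
structure IsEnum (M : ℕ) (A : ℕ → ℕ) : Prop where
  lt : ∀ x < M, A x < M
  surj : ∀ c < M, ∃ x < M, A x = c

theorem mergeBody_run {le : NExp → NExp → Test} (hw : 0 < w) (hM : 2 * w ∣ M)
    (htotal : ∀ c < M, ∀ d < M, r c d ∨ r d c)
    (htrans : ∀ c < M, ∀ d < M, ∀ g < M, r c d → r d g → r c g)
    (hA : ∀ x < M, A x < M) (hsorted : BlocksSorted r w M A) {s : State}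
    (hle : TestDenotes le s r) (h4 : s.nat 4 = w) (hs1 : s.natArr 1 = A) (ho : s.nat 5 < M)
    (H : MergeInv r w M A (s.natArr 2) st (s.nat 5) (s.nat 6) (s.nat 7) (s.nat 8) (s.nat 9)) :
    ∃ st', MergeInv r w M A (((Prog.seq mergeReset (mergeTake le)).run s).natArr 2) st'
      (s.nat 5 + 1) (((Prog.seq mergeReset (mergeTake le)).run s).nat 6)
      (((Prog.seq mergeReset (mergeTake le)).run s).nat 7)
      (((Prog.seq mergeReset (mergeTake le)).run s).nat 8)
      (((Prog.seq mergeReset (mergeTake le)).run s).nat 9) := by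
  have e1 : (Prog.seq mergeReset (mergeTake le)).run s = (mergeTake le).run (mergeReset.run s) := rfl
  obtain ⟨s1, hs⟩ : ∃ s1, s1 = mergeReset.run s := ⟨_, rfl⟩
  rw [e1, ← hs]
  have key : s1.nat 5 = s.nat 5 ∧ s1.natArr = s.natArr ∧ s1.realArr = s.realArr ∧
      s1.nat 5 < s1.nat 9 ∧ ∃ st', MergeInv r w M A (s1.natArr 2) st' (s1.nat 5) (s1.nat 6)
        (s1.nat 7) (s1.nat 8) (s1.nat 9) := by
    by_cases hc : s.nat 9 ≤ s.nat 5
    · refine ⟨by simp [hs, mergeReset, Prog.run, Test.Holds, NExp.eval, hc],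
        by simp [hs, mergeReset, Prog.run, Test.Holds, NExp.eval, hc],
        by simp [hs, mergeReset, Prog.run, Test.Holds, NExp.eval, hc], ?_, s.nat 5, ?_⟩
      · simp [hs, mergeReset, Prog.run, Test.Holds, NExp.eval, hc]; omega
      · simpa [hs, mergeReset, Prog.run, Test.Holds, NExp.eval, hc, h4] using H.reset hM ho hc
    · have : s1 = s := by simp [hs, mergeReset, Prog.run, Test.Holds, NExp.eval, hc]
      rw [this]
      exact ⟨rfl, rfl, rfl, not_le.1 hc, st, H⟩
  obtain ⟨h5, hN, hR, hlt, st', H1⟩ := key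
  have hs1' : s1.natArr 1 = A := by rw [hN, hs1]
  have hle1 : ∀ i j, (le i j).Holds s1 ↔ r (i.eval s1) (j.eval s1) := hle s1 hR
  have hrefl : ∀ c < M, r c c := fun c hc => (htotal c hc c hc).elim id id
  have hM9 := H1.e_le
  have hc := H1.count
  have ha := H1.a_le
  have hb := H1.b_le
  have hl := H1.l_le
  refine ⟨st', ?_⟩
  by_cases htl : s1.nat 6 < s1.nat 8 ∧ (s1.nat 7 < s1.nat 9 → r (A (s1.nat 6)) (A (s1.nat 7)))
  · have := H1.take hw hA hrefl (Or.inl ⟨rfl, htl.1, rfl, rfl⟩) (by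
      rintro x (⟨hx1, hx2⟩ | ⟨hx1, hx2⟩)
      · exact H1.left_sorted hw hsorted le_rfl hx1 hx2
      · exact htrans _ (hA _ (by omega)) _ (hA _ (by omega)) _ (hA _ (by omega))
          (htl.2 (by omega)) (H1.right_sorted hw hsorted le_rfl hx1 hx2))
    have hT : (takeLeft le).Holds s1 := by
      simp only [takeLeft, Test.Holds, hle1, NExp.eval, hs1', not_le]
      exact ⟨htl.1, fun h' => h'.2 (htl.2 h'.1)⟩
    simpa [mergeTake, Prog.run, NExp.eval, hs1', hT, ← h5] using this
  · have hb9 : s1.nat 7 < s1.nat 9 := by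
      by_contra h'
      exact htl ⟨by omega, fun h'' => absurd h'' h'⟩
    have := H1.take hw hA hrefl (Or.inr ⟨rfl, hb9, rfl, rfl⟩) (by
      rintro x (⟨hx1, hx2⟩ | ⟨hx1, hx2⟩)
      · have hba : r (A (s1.nat 7)) (A (s1.nat 6)) := by
          refine (htotal _ (hA _ (by omega)) _ (hA _ (by omega))).resolve_left fun h' => ?_
          exact htl ⟨by omega, fun _ => h'⟩
        exact htrans _ (hA _ (by omega)) _ (hA _ (by omega)) _ (hA _ (by omega))
          hba (H1.left_sorted hw hsorted le_rfl hx1 hx2)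
      · exact H1.right_sorted hw hsorted le_rfl hx1 hx2)
    have hT : ¬ (takeLeft le).Holds s1 := by
      simp only [takeLeft, Test.Holds, hle1, NExp.eval, hs1', not_le]
      exact fun h' => htl ⟨h'.1, fun h'' => by_contra fun h3 => h'.2 ⟨h'', h3⟩⟩
    simpa [mergeTake, Prog.run, NExp.eval, hs1', hT, ← h5] using this

theorem mergePass_runs (le : NExp → NExp → Test) : ∃ K, ∀ (s : State) (M w : ℕ)
    (r : ℕ → ℕ → Prop), s.nat 1 = M → s.nat 4 = w → 0 < w → 2 * w ∣ M → TestDenotes le s r →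
    (∀ c < M, ∀ d < M, r c d ∨ r d c) → (∀ c < M, ∀ d < M, ∀ g < M, r c d → r d g → r c g) →
    IsEnum M (s.natArr 1) → BlocksSorted r w M (s.natArr 1) →
    Runs (mergePass le) s (K * (M + 1)) fun s' =>
      IsEnum M (s'.natArr 1) ∧ BlocksSorted r (2 * w) M (s'.natArr 1) := by
  refine ⟨(Prog.seq mergeReset (mergeTake le)).bound + 50,
    fun s M w r h1 h4 hw hM hle htotal htrans hA hsorted => ?_⟩
  obtain ⟨s1, hs1⟩ : ∃ s1, s1 = (((s.setNat 6 0).setNat 7 0).setNat 8 0).setNat 9 0 := ⟨_, rfl⟩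
  have hloop : Runs (.forLoop 5 (.reg 1) (.seq mergeReset (mergeTake le))) s1 _ _ :=
    Runs.forLoop (N := M) (T := (Prog.seq mergeReset (mergeTake le)).bound)
    (fun k s' => ∃ st, MergeInv r w M (s.natArr 1) (s'.natArr 2) st k (s'.nat 6) (s'.nat 7)
      (s'.nat 8) (s'.nat 9)) ?_ ?_ ?_ ?_
  · have hcopy : ∀ s2, s2.nat 1 = M → Runs (.forLoop 5 (.reg 1)
        (.storeNat 1 (.reg 5) (.cell 2 (.reg 5)))) s2
          ((M + 1) * ((Prog.storeNat 1 (.reg 5) (.cell 2 (.reg 5))).bound + 1 + 10)) fun s' =>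
            ∀ x < M, s'.natArr 1 x = s2.natArr 2 x := fun s2 h2 =>
      Runs.forLoop (N := M) (T := (Prog.storeNat 1 (.reg 5) (.cell 2 (.reg 5))).bound)
        (fun k s' => ∀ x < k, s'.natArr 1 x = s2.natArr 2 x) (by decide)
        (fun s' hF => (hF.nat 1 (by simp [Prog.forLoop, Prog.natRegs])).trans h2) (by simp)
        (fun k hk s' hF h5 hI => Runs.of_run rfl (by
          have hb : s'.natArr 2 = s2.natArr 2 :=
            hF.natArr 2 (by simp [Prog.forLoop, Prog.natArrs])
          intro x hx
          by_cases hxk : x = k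
          · simp [Prog.run, NExp.eval, h5, hxk, hb]
          · simp [Prog.run, NExp.eval, h5, hxk, hI x (by omega)]))
    refine Runs.mono (Q := fun s' => IsEnum M (s'.natArr 1) ∧
      BlocksSorted r (2 * w) M (s'.natArr 1)) (Runs.step rfl (Runs.seq
        (T := (M + 1) * ((Prog.seq mergeReset (mergeTake le)).bound + 1 + 10))
        (T' := (M + 1) * ((Prog.storeNat 1 (.reg 5) (.cell 2 (.reg 5))).bound + 1 + 10)) ?_)) ?_
      fun _ _ h => h
    · simp only [Prog.run, NExp.eval]
      rw [← hs1]
      refine hloop.mono le_rfl fun s2 hF ⟨st, H⟩ => (hcopy s2 ?_).mono le_rfl fun s3 _ h3 => ?_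
      · exact (hF.nat 1 (by simp [Prog.forLoop, Prog.natRegs, mergeReset, mergeTake])).trans
          (by simp [hs1, h1])
      · have hc := H.count
        have ha := H.a_le
        have hb := H.b_le
        have hl := H.l_le
        have he := H.e_le
        refine ⟨⟨fun x hx => ?_, fun c hc' => ?_⟩, fun x y hxy hy hd => ?_⟩
        · rw [h3 x hx]; exact H.range x hx
        · obtain ⟨x, hx, rfl⟩ := hA.surj c hc'
          obtain ⟨y, hy, hyx⟩ := H.cover x (by omega)
          exact ⟨y, hy, by rw [h3 y hy, hyx]⟩
        · rw [h3 x (by omega), h3 y hy]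
          exact H.sorted x y hxy hy hd
    · simp only [Prog.bound, NExp.cost]
      nlinarith
  · simp [Prog.natRegs, mergeReset, mergeTake]
  · intro s' hF
    exact (hF.nat 1 (by simp [Prog.forLoop, Prog.natRegs, mergeReset, mergeTake])).trans
      (by simp [hs1, h1])
  · refine ⟨0, ?_⟩
    simp only [hs1, setNat_natArr, setNat_nat]
    norm_num
    constructor <;> simp
  · rintro k hk s' hF h5 ⟨st, H⟩
    refine Runs.of_run rfl ?_
    subst h5
    have := mergeBody_run hw hM htotal htrans hA.lt hsorted (le := le) (s := s') (st := st) ?_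
      ?_ ?_ hk H
    · simpa using this
    · intro s'' hs''
      exact hle s'' (hs''.trans (funext fun a => (hF.realArr a (by simp [Prog.forLoop,
        Prog.realArrs, mergeReset, mergeTake])).trans (by rw [hs1]; rfl)))
    · exact (hF.nat 4 (by simp [Prog.forLoop, Prog.natRegs, mergeReset, mergeTake])).trans
        (by simp [hs1, h4])
    · exact (hF.natArr 1 (by simp [Prog.forLoop, Prog.natArrs, mergeReset, mergeTake])).trans
        (by rw [hs1]; rfl)

theorem sortProg_runs (le : NExp → NExp → Test) : ∃ K, ∀ (s : State) (h : ℕ)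
    (r : ℕ → ℕ → Prop), s.nat 1 = 2 ^ h → TestDenotes le s r →
    (∀ c < 2 ^ h, ∀ d < 2 ^ h, r c d ∨ r d c) →
    (∀ c < 2 ^ h, ∀ d < 2 ^ h, ∀ g < 2 ^ h, r c d → r d g → r c g) →
    IsEnum (2 ^ h) (s.natArr 1) →
    Runs (sortProg le) s (K * (2 ^ h * (h + 1))) fun s' => IsEnum (2 ^ h) (s'.natArr 1) ∧
      ∀ x y, x ≤ y → y < 2 ^ h → r (s'.natArr 1 x) (s'.natArr 1 y) := by
  obtain ⟨K, hK⟩ := mergePass_runs le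
  refine ⟨2 * K + 30, fun s h r h1 hle htotal htrans hA => ?_⟩
  have hloop := Runs.loop (b := .natLT (.reg 4) (.reg 1))
    (P := .seq (mergePass le) (.setNat 4 (.add (.reg 4) (.reg 4)))) (s₀ := s.setNat 4 1) (N := h)
    (T := K * (2 ^ h + 1) + 4)
    (fun k s' => s'.nat 4 = 2 ^ k ∧ IsEnum (2 ^ h) (s'.natArr 1) ∧
      BlocksSorted r (2 ^ k) (2 ^ h) (s'.natArr 1)) ?_ ?_ ?_
  · refine Runs.mono (Runs.step (P := .setNat 4 (.const 1)) rfl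
      (by simpa [Prog.run, NExp.eval] using hloop)) ?_ ?_
    · have : 1 ≤ 2 ^ h := Nat.one_le_two_pow
      simp only [Prog.bound, NExp.cost, Test.cost]
      have h2 : h ≤ 2 ^ h * h := Nat.le_mul_of_pos_left _ (by positivity)
      have h3 : K ≤ K * 2 ^ h := Nat.le_mul_of_pos_right _ (by positivity)
      have h4 : K * h ≤ K * (2 ^ h * h) := Nat.mul_le_mul_left _ h2
      nlinarith
    · rintro s' _ ⟨-, hE, hS⟩
      refine ⟨hE, fun x y hxy hy => hS x y hxy hy ?_⟩
      rw [Nat.div_eq_of_lt hy, Nat.div_eq_of_lt (by omega)]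
  · refine ⟨by simp, by simpa using hA, fun x y hxy hy hd => ?_⟩
    simp only [pow_zero, Nat.div_one] at hd
    subst hd
    exact (htotal _ (hA.lt x hy) _ (hA.lt x hy)).elim id id
  · rintro k hk s' hF ⟨h4, hE, hS⟩
    have h1' : s'.nat 1 = 2 ^ h :=
      (hF.nat 1 (by simp [Prog.natRegs, mergePass, Prog.forLoop, mergeReset, mergeTake])).trans
        (by simp [h1])
    have hR : s'.realArr = s.realArr := funext fun a => hF.realArr a
      (by simp [Prog.realArrs, mergePass, Prog.forLoop, mergeReset, mergeTake])
    refine ⟨?_, Runs.seq ((hK s' (2 ^ h) (2 ^ k) r h1' h4 (by positivity) ?_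
      (fun s'' hs'' => hle s'' (hs''.trans hR)) htotal htrans hE hS).mono le_rfl
        fun s'' hF' ⟨hE', hS'⟩ => ?_)⟩
    · simp only [Test.Holds, NExp.eval, h4, h1', not_le]
      exact Nat.pow_lt_pow_right (by norm_num) hk
    · rw [← pow_succ']; exact Nat.pow_dvd_pow _ hk
    · have : s''.nat 4 = 2 ^ k := (hF'.nat 4 (by simp [Prog.natRegs, mergePass, Prog.forLoop,
        mergeReset, mergeTake])).trans h4
      refine Runs.of_run (P := .setNat 4 (.add (.reg 4) (.reg 4))) rfl ?_
      refine ⟨by simp [Prog.run, NExp.eval, this, pow_succ, mul_two], by simpa [Prog.run] using hE', ?_⟩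
      rw [pow_succ']
      simpa [Prog.run] using hS'
  · rintro s' hF ⟨h4, -⟩
    have h1' : s'.nat 1 = 2 ^ h :=
      (hF.nat 1 (by simp [Prog.natRegs, mergePass, Prog.forLoop, mergeReset, mergeTake])).trans
        (by simp [h1])
    simp [Test.Holds, NExp.eval, h4, h1']

end MergeSort

/-! ### Directions and the two families of functions -/

section Directions

/-- The chosen representatives of the directions of lines through the origin: `(c, 1)` and
`(1, 0)`. -/
def IsDir (c d : ℝ) : Prop := d = 1 ∨ (c = 1 ∧ d = 0)

theorem dir_trans {c d c' d' c'' d'' : ℝ} (h : IsDir c d) (h' : IsDir c' d') (h'' : IsDir c'' d'')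
    (h₁ : c * d' ≤ c' * d) (h₂ : c' * d'' ≤ c'' * d') : c * d'' ≤ c'' * d := by
  rcases h with rfl | ⟨rfl, rfl⟩ <;> rcases h' with rfl | ⟨rfl, rfl⟩ <;>
    rcases h'' with rfl | ⟨rfl, rfl⟩ <;> linarith

/-- A later direction is a nonnegative combination of an earlier one and of the last one. -/
theorem dir_combination {c d c' d' : ℝ} (h : IsDir c d) (h' : IsDir c' d')
    (hle : c * d' ≤ c' * d) :
    ∃ α β : ℝ, 0 ≤ α ∧ 0 ≤ β ∧ 0 < α + β ∧ c' = α * c + β ∧ d' = α * d := by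
  rcases h with rfl | ⟨rfl, rfl⟩ <;> rcases h' with rfl | ⟨rfl, rfl⟩
  · exact ⟨1, c' - c, by norm_num, by linarith, by linarith, by ring, by ring⟩
  · exact ⟨0, 1, by norm_num, by norm_num, by norm_num, by ring, by ring⟩
  · linarith
  · exact ⟨1, 0, by norm_num, by norm_num, by norm_num, by ring, by ring⟩

/-- The cross product of the `k`-th vector `(a, b)` with the `x`-th direction `(c, d)`. -/
def crossVal (a b c d : ℕ → ℝ) (k x : ℕ) : ℝ := a k * d x - b k * c x

/-- The length of the `k`-th vector `(a, b)` if it makes an obtuse or right angle with the `x`-th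
direction `(c, d)`, and `0` otherwise. -/
def stepVal (a b c d : ℕ → ℝ) (k x : ℕ) : ℝ :=
  if a k * c x + b k * d x ≤ 0 then √(a k * a k + b k * b k) else 0

theorem stepVal_nonneg (a b c d : ℕ → ℝ) (k x : ℕ) : 0 ≤ stepVal a b c d k x := by
  unfold stepVal; split_ifs <;> positivity

/-- The side test for `crossVal`, which compares the values in the direction `(1, 0)`. -/
def crossLeft (b : ℕ → ℝ) (l w _m : ℕ) : Prop := b w ≤ b l

/-- The side test for `stepVal`. The directions where `stepVal` is positive form an initial or a
final segment, according to the sign of `a`. -/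
def stepLeft (a b c d : ℕ → ℝ) (l w m : ℕ) : Prop :=
  ¬ (stepVal a b c d l m ≤ 0 ∧ a l ≤ 0) ∧ ¬ (¬ stepVal a b c d l m ≤ 0 ∧ ¬ a w ≤ 0)

variable {a b c d : ℕ → ℝ} {M : ℕ}

theorem crossVal_singleCrossing (hdir : ∀ x < M, IsDir (c x) (d x))
    (hsort : ∀ x y, x ≤ y → y < M → c x * d y ≤ c y * d x) :
    SingleCrossing (crossVal a b c d) (crossLeft b) M := by
  intro l w m hm hle
  unfold crossVal at hle ⊢
  unfold crossLeft
  constructor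
  · intro hl z hmz hz
    obtain ⟨α, β, hα, hβ, -, hc, hd⟩ := dir_combination (hdir m hm) (hdir z hz) (hsort m z hmz hz)
    rw [hc, hd]
    have h1 := mul_le_mul_of_nonneg_left hle hα
    have h2 := mul_le_mul_of_nonneg_left hl hβ
    linarith
  · intro hl x hx
    obtain ⟨α, β, hα, hβ, hαβ, hc, hd⟩ := dir_combination (hdir x (by omega)) (hdir m hm)
      (hsort x m hx.le hm)
    rw [hc, hd] at hle
    by_contra hcon
    rw [not_le] at hl hcon
    rcases hα.lt_or_eq with h | rfl
    · have h1 := mul_lt_mul_of_pos_left hcon h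
      have h2 := mul_le_mul_of_nonneg_left hl.le hβ
      linarith
    · have h2 := mul_lt_mul_of_pos_left hl (show 0 < β by linarith)
      linarith

theorem stepVal_singleCrossing (hdir : ∀ x < M, IsDir (c x) (d x))
    (hsort : ∀ x y, x ≤ y → y < M → c x * d y ≤ c y * d x) :
    SingleCrossing (stepVal a b c d) (stepLeft a b c d) M := by
  have mono : ∀ k x y, x ≤ y → y < M → a k ≤ 0 → a k * c x + b k * d x ≤ 0 →
      a k * c y + b k * d y ≤ 0 := by
    intro k x y hxy hy ha hx
    obtain ⟨α, β, hα, hβ, -, hc, hd⟩ := dir_combination (hdir x (by omega)) (hdir y hy)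
      (hsort x y hxy hy)
    rw [hc, hd]
    have h1 := mul_nonpos_of_nonneg_of_nonpos hα hx
    have h2 := mul_nonpos_of_nonneg_of_nonpos hβ ha
    linarith
  have anti : ∀ k x y, x ≤ y → y < M → 0 < a k → a k * c y + b k * d y ≤ 0 →
      a k * c x + b k * d x ≤ 0 := by
    intro k x y hxy hy ha hyy
    obtain ⟨α, β, hα, hβ, hαβ, hc, hd⟩ := dir_combination (hdir x (by omega)) (hdir y hy)
      (hsort x y hxy hy)
    rw [hc, hd] at hyy
    by_contra hcon
    rw [not_le] at hcon
    rcases hα.lt_or_eq with h | rfl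
    · have h1 := mul_pos h hcon
      have h2 := mul_nonneg hβ ha.le
      linarith
    · have h2 := mul_pos (show 0 < β by linarith) ha
      linarith
  intro l w m hm hle
  -- The remaining case distinction does not depend on the position that is compared with `m`.
  have key : ∀ z, (stepVal a b c d l m ≤ 0 → a l * c z + b l * d z ≤ 0 →
        a l * c m + b l * d m ≤ 0) →
      (¬ stepVal a b c d l m ≤ 0 → a w * c m + b w * d m ≤ 0 → a w * c z + b w * d z ≤ 0) →
      stepVal a b c d l z ≤ stepVal a b c d w z := by
    intro z h1 h2
    by_cases hz : a l * c z + b l * d z ≤ 0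
    · by_cases h0 : stepVal a b c d l m ≤ 0
      · have h3 := h1 h0 hz
        rw [stepVal, if_pos h3] at h0
        rw [stepVal, if_pos hz]
        exact h0.trans (stepVal_nonneg _ _ _ _ _ _)
      · have hlm : stepVal a b c d l m = √(a l * a l + b l * b l) := by
          unfold stepVal at h0 ⊢
          split_ifs at h0 ⊢ with h
          · rfl
          · simp at h0
        have hwm : a w * c m + b w * d m ≤ 0 := by
          by_contra h
          rw [stepVal.eq_def a b c d w m, if_neg h] at hle
          exact h0 hle
        rw [stepVal.eq_def a b c d w m, if_pos hwm, hlm] at hle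
        rwa [stepVal, if_pos hz, stepVal, if_pos (h2 h0 hwm)]
    · rw [stepVal, if_neg hz]
      exact stepVal_nonneg _ _ _ _ _ _
  unfold stepLeft
  constructor
  · intro hl z hmz hz
    refine key z (fun h0 h1 => ?_) (fun h0 h1 => ?_)
    · exact anti l m z hmz hz (not_le.1 fun h => hl.1 ⟨h0, h⟩) h1
    · exact mono w m z hmz hz (by_contra fun h => hl.2 ⟨h0, h⟩) h1
  · intro hl x hx
    refine key x (fun h0 h1 => ?_) (fun h0 h1 => ?_)
    · refine mono l x m hx.le hm (by_contra fun h => hl ⟨fun h' => h h'.2, fun h' => h'.1 h0⟩) h1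
    · refine anti w x m hx.le hm (not_le.1 fun h => hl ⟨fun h' => h0 h'.1, fun h' => h'.2 h⟩) h1

/-- The `x`-coordinate of the `k`-th vector. -/
abbrev vecX (k : NExp) : RExp := .cell 3 k
/-- The `y`-coordinate of the `k`-th vector. -/
abbrev vecY (k : NExp) : RExp := .cell 4 k
/-- The `x`-coordinate of the direction at position `x` in sorted order. -/
abbrev dirX (x : NExp) : RExp := .cell 5 (.cell 1 x)
/-- The `y`-coordinate of the direction at position `x` in sorted order. -/
abbrev dirY (x : NExp) : RExp := .cell 6 (.cell 1 x)

/-- The functions `crossVal` of the vectors stored in memory. -/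
def crossFam : Family where
  val k x := .sub (.mul (vecX k) (dirY x)) (.mul (vecY k) (dirX x))
  left l w _ := .realLE (vecY w) (vecY l)

/-- The inner product of the `k`-th vector with the direction at position `x`. -/
def dotExp (k x : NExp) : RExp := .add (.mul (vecX k) (dirX x)) (.mul (vecY k) (dirY x))

/-- An expression for `stepVal`. The quotient `√s / √s` is `1` for `s > 0`, and `0` for `s ≤ 0`
because square roots of negative numbers and quotients by zero are zero on the machine. -/
def stepExp (k x : NExp) : RExp :=
  .mul (.sqrt (.add (.mul (vecX k) (vecX k)) (.mul (vecY k) (vecY k))))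
    (.sub (.const 1) (.div (.sqrt (dotExp k x)) (.sqrt (dotExp k x))))

/-- The functions `stepVal` of the vectors stored in memory. -/
def stepFam : Family where
  val := stepExp
  left l w m := .conj (.neg (.conj (.realLE (stepExp l m) (.const 0)) (.realLE (vecX l) (.const 0))))
    (.neg (.conj (.neg (.realLE (stepExp l m) (.const 0))) (.neg (.realLE (vecX w) (.const 0)))))

theorem crossFam_denotes (s : State) : crossFam.Denotes s
    (crossVal (s.realArr 3) (s.realArr 4) (fun x => s.realArr 5 (s.natArr 1 x))
      (fun x => s.realArr 6 (s.natArr 1 x))) (crossLeft (s.realArr 4)) := by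
  intro s' hR hN
  have h3 := hR 3 (by norm_num)
  have h4 := hR 4 (by norm_num)
  have h5 := hR 5 (by norm_num)
  have h6 := hR 6 (by norm_num)
  refine ⟨fun k x => ?_, fun l w m => ?_⟩
  · simp [crossFam, RExp.eval, NExp.eval, crossVal, h3, h4, h5, h6, hN]
  · simp [crossFam, Test.Holds, RExp.eval, crossLeft, h4]

theorem stepFam_denotes (s : State) : stepFam.Denotes s
    (stepVal (s.realArr 3) (s.realArr 4) (fun x => s.realArr 5 (s.natArr 1 x))
      (fun x => s.realArr 6 (s.natArr 1 x)))
    (stepLeft (s.realArr 3) (s.realArr 4) (fun x => s.realArr 5 (s.natArr 1 x))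
      (fun x => s.realArr 6 (s.natArr 1 x))) := by
  intro s' hR hN
  have h3 := hR 3 (by norm_num)
  have h4 := hR 4 (by norm_num)
  have h5 := hR 5 (by norm_num)
  have h6 := hR 6 (by norm_num)
  have hval : ∀ k x, (stepExp k x).eval s' = stepVal (s.realArr 3) (s.realArr 4)
      (fun x => s.realArr 5 (s.natArr 1 x)) (fun x => s.realArr 6 (s.natArr 1 x))
      (k.eval s') (x.eval s') := by
    intro k x
    simp only [stepExp, dotExp, RExp.eval, NExp.eval, stepVal, h3, h4, h5, h6, hN]
    split_ifs with h
    · rw [Real.sqrt_eq_zero_of_nonpos h]; simp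
    · rw [div_self (Real.sqrt_pos.2 (not_le.1 h)).ne']; simp
  refine ⟨hval, fun l w m => ?_⟩
  simp only [stepFam, Test.Holds, hval, stepLeft]
  simp [RExp.eval, h3]

end Directions

/-! ### The sweep around a base point -/

theorem Family.Denotes.congr {F : Family} {s s' : State} {f : ℕ → ℕ → ℝ} {lf : ℕ → ℕ → ℕ → Prop}
    (H : F.Denotes s f lf) (hR : ∀ a, a ≠ 2 → s'.realArr a = s.realArr a)
    (hN : s'.natArr 1 = s.natArr 1) : F.Denotes s' f lf := fun s'' hR' hN' =>
  H s'' (fun a ha => (hR' a ha).trans (hR a ha)) (hN'.trans hN)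

/-- Insertion of the function with number `e`. -/
def insertAt (t : ℕ) (F : Family) (e : NExp) : Prog := .seq (.setNat 10 e) (insertProg t F)

theorem insertAt_runs (t : ℕ) (ht : t ≠ 1) (F : Family) (e : NExp) : ∃ K, ∀ (h : ℕ) (s : State)
    (f : ℕ → ℕ → ℝ) (lf : ℕ → ℕ → ℕ → Prop), s.nat 1 = 2 ^ h → F.Denotes s f lf →
    SingleCrossing f lf (2 ^ h) →
    Runs (insertAt t F e) s (K * (h + 1)) fun s' => ∀ x < 2 ^ h, ∀ b : ℝ,
      PathLE f h (s'.natArr t) x b ↔ PathLE f h (s.natArr t) x b ∧ f (e.eval s) x ≤ b := by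
  obtain ⟨K, hK⟩ := insertProg_runs t ht F
  refine ⟨K + (e.cost + 1), fun h s f lf hM hD hsc => ?_⟩
  refine (Runs.step (P := .setNat 10 e) rfl (hK h (s.setNat 10 (e.eval s)) f lf (by simpa using hM)
    (hD.congr (fun _ _ => rfl) rfl) hsc)).mono ?_ fun s' _ H => by simpa using H
  simp only [Prog.bound]
  nlinarith

/-- Insertion of the vector with number `nat 3` and of its opposite. -/
def insertAll : Prog :=
  .seq (insertAt 4 crossFam (.reg 3)) <|
  .seq (insertAt 4 crossFam (.add (.reg 3) (.reg 1))) <|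
  .seq (insertAt 5 stepFam (.reg 3)) <|
  insertAt 6 stepFam (.add (.reg 3) (.reg 1))

theorem insertAll_runs : ∃ K, ∀ (h : ℕ) (s : State) (f g : ℕ → ℕ → ℝ)
    (lf lg : ℕ → ℕ → ℕ → Prop), s.nat 1 = 2 ^ h → crossFam.Denotes s f lf →
    SingleCrossing f lf (2 ^ h) → stepFam.Denotes s g lg → SingleCrossing g lg (2 ^ h) →
    Runs insertAll s (K * (h + 1)) fun s' => ∀ x < 2 ^ h, ∀ b : ℝ,
      (PathLE f h (s'.natArr 4) x b ↔
        PathLE f h (s.natArr 4) x b ∧ f (s.nat 3) x ≤ b ∧ f (s.nat 3 + 2 ^ h) x ≤ b) ∧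
      (PathLE g h (s'.natArr 5) x b ↔ PathLE g h (s.natArr 5) x b ∧ g (s.nat 3) x ≤ b) ∧
      (PathLE g h (s'.natArr 6) x b ↔ PathLE g h (s.natArr 6) x b ∧ g (s.nat 3 + 2 ^ h) x ≤ b) := by
  obtain ⟨K1, h1⟩ := insertAt_runs 4 (by norm_num) crossFam (.reg 3)
  obtain ⟨K2, h2⟩ := insertAt_runs 4 (by norm_num) crossFam (.add (.reg 3) (.reg 1))
  obtain ⟨K3, h3⟩ := insertAt_runs 5 (by norm_num) stepFam (.reg 3)
  obtain ⟨K4, h4⟩ := insertAt_runs 6 (by norm_num) stepFam (.add (.reg 3) (.reg 1))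
  refine ⟨K1 + (K2 + (K3 + K4)), fun h s f g lf lg hM hf hfs hg hgs => ?_⟩
  simp only [add_mul]
  refine Runs.seq ((h1 h s f lf hM hf hfs).mono le_rfl fun s1 F1 H1 => ?_)
  have a1 := F1.nat 1 (by decide)
  have a3 := F1.nat 3 (by decide)
  have aR : ∀ a, a ≠ 2 → s1.realArr a = s.realArr a := fun a _ => F1.realArr a (by
    simp [insertAt, insertProg, insertBody, insertLoad, insertSwap, insertMove, Prog.realArrs])
  have aN := F1.natArr 1 (by decide)
  have a5 := F1.natArr 5 (by decide)
  have a6 := F1.natArr 6 (by decide)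
  refine Runs.seq ((h2 h s1 f lf (a1.trans hM) (hf.congr aR aN) hfs).mono le_rfl
    fun s2 F2 H2 => ?_)
  have b1 := (F2.nat 1 (by decide)).trans a1
  have b3 := (F2.nat 3 (by decide)).trans a3
  have bR : ∀ a, a ≠ 2 → s2.realArr a = s.realArr a := fun a ha => (F2.realArr a (by
    simp [insertAt, insertProg, insertBody, insertLoad, insertSwap, insertMove,
      Prog.realArrs])).trans (aR a ha)
  have bN := (F2.natArr 1 (by decide)).trans aN
  have b5 := (F2.natArr 5 (by decide)).trans a5
  have b6 := (F2.natArr 6 (by decide)).trans a6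
  refine Runs.seq ((h3 h s2 g lg (b1.trans hM) (hg.congr bR bN) hgs).mono le_rfl
    fun s3 F3 H3 => ?_)
  have c1 := (F3.nat 1 (by decide)).trans b1
  have c3 := (F3.nat 3 (by decide)).trans b3
  have cR : ∀ a, a ≠ 2 → s3.realArr a = s.realArr a := fun a ha => (F3.realArr a (by
    simp [insertAt, insertProg, insertBody, insertLoad, insertSwap, insertMove,
      Prog.realArrs])).trans (bR a ha)
  have cN := (F3.natArr 1 (by decide)).trans bN
  have c4 := F3.natArr 4 (by decide)
  have c6 := (F3.natArr 6 (by decide)).trans b6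
  refine (h4 h s3 g lg (c1.trans hM) (hg.congr cR cN) hgs).mono le_rfl
    fun s4 F4 H4 x hx b => ?_
  have d4 := (F4.natArr 4 (by decide)).trans c4
  have d5 := F4.natArr 5 (by decide)
  simp only [NExp.eval, a1, a3, b3, c1, c3, hM] at H1 H2 H3 H4
  rw [d4, d5, H4 x hx b, H3 x hx b, H2 x hx b, H1 x hx b, b5, c6]
  exact ⟨and_assoc, Iff.rfl, Iff.rfl⟩

/-- The inner product of the current vector with its own normalized direction. -/
abbrev ownDot : RExp := dotExp (.reg 3) (.reg 19)

/-- The length of the normalized direction of the current vector. -/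
abbrev ownNorm : RExp :=
  .sqrt (.add (.mul (dirX (.reg 19)) (dirX (.reg 19))) (.mul (dirY (.reg 19)) (dirY (.reg 19))))

/-- Raise the real register `1` to the value of the real register `0` if `t` holds. -/
def raiseIf (t : Test) : Prog :=
  .ite (.conj t (.neg (.realLE (.reg 0) (.reg 1)))) (.setReal 1 (.reg 0)) .skip

/-- Store in the real register `1` the maximal distance of the vectors inserted so far from the ray
of the current vector. -/
def queryAll : Prog :=
  .seq (.setNat 19 (.cell 3 (.reg 3))) <|
  .seq (queryProg 4 crossFam) <| .seq (.setReal 1 (.div (.reg 0) ownNorm)) <|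
  .seq (queryProg 5 stepFam) <| .seq (raiseIf (.realLE (.const 0) ownDot)) <|
  .seq (queryProg 6 stepFam) (raiseIf (.realLE ownDot (.const 0)))

theorem queryAll_runs : ∃ K, ∀ (h : ℕ) (s : State) (f g : ℕ → ℕ → ℝ)
    (lf lg : ℕ → ℕ → ℕ → Prop), s.nat 1 = 2 ^ h → crossFam.Denotes s f lf →
    stepFam.Denotes s g lg → ∀ x, s.natArr 3 (s.nat 3) = x → x < 2 ^ h →
    s.natArr 1 x = s.nat 3 → ∀ u v u' v' : ℝ, s.realArr 3 (s.nat 3) = u' →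
    s.realArr 4 (s.nat 3) = v' → s.realArr 5 (s.nat 3) = u → s.realArr 6 (s.nat 3) = v →
    0 < √(u * u + v * v) →
    Runs queryAll s (K * (h + 1)) fun s' => ∀ b : ℝ, 0 ≤ b → (s'.real 1 ≤ b ↔
      PathLE f h (s.natArr 4) x (b * √(u * u + v * v)) ∧
      (0 ≤ u' * u + v' * v → PathLE g h (s.natArr 5) x b) ∧
      (u' * u + v' * v ≤ 0 → PathLE g h (s.natArr 6) x b)) := by
  obtain ⟨K1, h1⟩ := queryProg_runs 4 crossFam
  obtain ⟨K2, h2⟩ := queryProg_runs 5 stepFam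
  obtain ⟨K3, h3⟩ := queryProg_runs 6 stepFam
  refine ⟨K1 + K2 + K3 + (Prog.setNat 19 (.cell 3 (.reg 3))).bound +
    (Prog.setReal 1 (.div (.reg 0) ownNorm)).bound +
    (raiseIf (.realLE (.const 0) ownDot)).bound + (raiseIf (.realLE ownDot (.const 0))).bound,
    fun h s f g lf lg hM hf hg x hx hxM hxi u v u' v' hu' hv' hu hv hn => ?_⟩
  have hraise : ∀ (t : Test) (s' : State), ((raiseIf t).run s').nat = s'.nat ∧
      ((raiseIf t).run s').natArr = s'.natArr ∧ ((raiseIf t).run s').realArr = s'.realArr ∧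
      ∀ b : ℝ, ((raiseIf t).run s').real 1 ≤ b ↔
        s'.real 1 ≤ b ∧ (t.Holds s' → s'.real 0 ≤ b) := by
    intro t s'
    by_cases hc : t.Holds s' ∧ ¬ s'.real 0 ≤ s'.real 1
    · have : (raiseIf t).run s' = s'.setReal 1 (s'.real 0) := if_pos hc
      rw [this]
      refine ⟨rfl, rfl, rfl, fun b => ?_⟩
      simp only [setReal_real, if_true]
      exact ⟨fun h' => ⟨((not_le.1 hc.2).le).trans h', fun _ => h'⟩, fun h' => h'.2 hc.1⟩
    · have : (raiseIf t).run s' = s' := if_neg hc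
      rw [this]
      refine ⟨rfl, rfl, rfl, fun b => ⟨fun h' => ⟨h', fun ht => ?_⟩, fun h' => h'.1⟩⟩
      exact (not_not.1 fun h'' => hc ⟨ht, h''⟩).trans h'
  refine Runs.mono (Runs.step (P := .setNat 19 (.cell 3 (.reg 3))) rfl ?_
    (T := K1 * (h + 1) + ((Prog.setReal 1 (.div (.reg 0) ownNorm)).bound + (K2 * (h + 1) +
      ((raiseIf (.realLE (.const 0) ownDot)).bound + (K3 * (h + 1) +
      (raiseIf (.realLE ownDot (.const 0))).bound)))))) ?_ fun _ _ h => h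
  swap
  · nlinarith [Nat.zero_le ((Prog.setNat 19 (.cell 3 (.reg 3))).bound * h),
      Nat.zero_le ((Prog.setReal 1 (.div (.reg 0) ownNorm)).bound * h),
      Nat.zero_le ((raiseIf (.realLE (.const 0) ownDot)).bound * h),
      Nat.zero_le ((raiseIf (.realLE ownDot (.const 0))).bound * h)]
  obtain ⟨s0, hs0⟩ : ∃ s0, s0 = (Prog.setNat 19 (.cell 3 (.reg 3))).run s := ⟨_, rfl⟩
  rw [← hs0]
  have z1 : s0.nat 1 = 2 ^ h := by simp [hs0, Prog.run, hM]
  have z3 : s0.nat 3 = s.nat 3 := by simp [hs0, Prog.run]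
  have z19 : s0.nat 19 = x := by simp [hs0, Prog.run, NExp.eval, hx]
  have zR : s0.realArr = s.realArr := by simp [hs0, Prog.run]
  have zN : s0.natArr = s.natArr := by simp [hs0, Prog.run]
  have stat : ∀ s' : State, s'.nat 3 = s.nat 3 → s'.nat 19 = x → s'.realArr = s.realArr →
      s'.natArr = s.natArr → ownDot.eval s' = u' * u + v' * v ∧
        ownNorm.eval s' = √(u * u + v * v) := by
    intro s' e1 e2 e3 e4
    simp [ownDot, dotExp, RExp.eval, NExp.eval, e1, e2, e3, e4, hxi, hu', hv', hu, hv]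
  have fr : ∀ {t F s s'}, Frame (queryProg t F) s s' → s'.realArr = s.realArr ∧
      s'.natArr = s.natArr := fun hF => ⟨funext fun a => hF.realArr a (by
        simp [queryProg, queryBody, Prog.realArrs]), funext fun a => hF.natArr a (by
        simp [queryProg, queryBody, Prog.natArrs])⟩
  refine Runs.seq ((h1 h s0 f lf z1 (hf.congr (fun a _ => by rw [zR]) (by rw [zN]))
    (by rw [z19]; exact hxM)).mono le_rfl fun s1 F1 H1 => ?_)
  have a1 := (F1.nat 1 (by decide)).trans z1
  have a3 := (F1.nat 3 (by decide)).trans z3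
  have a19 := (F1.nat 19 (by decide)).trans z19
  have aR := (fr F1).1.trans zR
  have aN := (fr F1).2.trans zN
  refine Runs.seq (Runs.of_run rfl ?_)
  obtain ⟨s2, hs2⟩ : ∃ s2, s2 = (Prog.setReal 1 (.div (.reg 0) ownNorm)).run s1 := ⟨_, rfl⟩
  rw [← hs2]
  have b1 : s2.nat 1 = 2 ^ h := by simp [hs2, Prog.run, a1]
  have b3 : s2.nat 3 = s.nat 3 := by simp [hs2, Prog.run, a3]
  have b19 : s2.nat 19 = x := by simp [hs2, Prog.run, a19]
  have bR : s2.realArr = s.realArr := by simp [hs2, Prog.run, aR]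
  have bN : s2.natArr = s.natArr := by simp [hs2, Prog.run, aN]
  have bv : s2.real 1 = s1.real 0 / √(u * u + v * v) := by
    have := (stat s1 a3 a19 aR aN).2
    simp [hs2, Prog.run, ← this, RExp.eval]
  refine Runs.seq ((h2 h s2 g lg b1 (hg.congr (fun a _ => by rw [bR]) (by rw [bN]))
    (by rw [b19]; exact hxM)).mono le_rfl fun s3 F3 H3 => ?_)
  have c1 := (F3.nat 1 (by decide)).trans b1
  have c3 := (F3.nat 3 (by decide)).trans b3
  have c19 := (F3.nat 19 (by decide)).trans b19
  have cR := (fr F3).1.trans bR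
  have cN := (fr F3).2.trans bN
  have cv := (F3.real 1 (by decide)).trans bv
  refine Runs.seq (Runs.of_run rfl ?_)
  obtain ⟨e1, e2, e3, e4⟩ := hraise (.realLE (.const 0) ownDot) s3
  refine Runs.seq ((h3 h _ g lg (by rw [e1]; exact c1)
    (hg.congr (fun a _ => by rw [e3, cR]) (by rw [e2, cN]))
    (by rw [e1, c19]; exact hxM)).mono le_rfl fun s4 F4 H4 => ?_)
  have d3 := (F4.nat 3 (by decide)).trans (by rw [e1, c3])
  have d19 := (F4.nat 19 (by decide)).trans (by rw [e1, c19])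
  have dR := (fr F4).1.trans (e3.trans cR)
  have dN := (fr F4).2.trans (e2.trans cN)
  have dv := F4.real 1 (by decide)
  refine Runs.of_run rfl fun b hb => ?_
  rw [(hraise (.realLE ownDot (.const 0)) s4).2.2.2 b, dv, e4 b, cv, div_le_iff₀ hn,
    H1 (b * √(u * u + v * v)), H3 b, H4 b, z19, b19, e1, c19, zN, bN, e2, cN]
  simp only [Test.Holds, (stat s3 c3 c19 cR cN).1, (stat s4 d3 d19 dR dN).1, RExp.eval, Rat.cast_zero]
  have := mul_nonneg hb hn.le
  tauto

/-- One round of the sweep; `addr` is the cell of the output that is to be raised. -/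
def sweepBody (addr : NExp) : Prog :=
  .seq insertAll <| .seq queryAll <|
  .ite (.realLE (.reg 1) (.cell 2 addr)) .skip (.storeReal 2 addr (.reg 1))

theorem sweepBody_runs (addr : NExp) : ∃ K, ∀ (h : ℕ) (s : State) (f g : ℕ → ℕ → ℝ)
    (lf lg : ℕ → ℕ → ℕ → Prop), s.nat 1 = 2 ^ h → crossFam.Denotes s f lf →
    SingleCrossing f lf (2 ^ h) → stepFam.Denotes s g lg → SingleCrossing g lg (2 ^ h) →
    ∀ a, (∀ s', s'.nat 2 = s.nat 2 → s'.nat 3 = s.nat 3 → s'.natArr 0 = s.natArr 0 →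
      addr.eval s' = a) →
    ∀ x, s.natArr 3 (s.nat 3) = x → x < 2 ^ h →
    s.natArr 1 x = s.nat 3 → ∀ u v u' v' : ℝ, s.realArr 3 (s.nat 3) = u' →
    s.realArr 4 (s.nat 3) = v' → s.realArr 5 (s.nat 3) = u → s.realArr 6 (s.nat 3) = v →
    0 < √(u * u + v * v) →
    Runs (sweepBody addr) s (K * (h + 1)) fun s' =>
      (∀ x < 2 ^ h, ∀ b : ℝ,
      (PathLE f h (s'.natArr 4) x b ↔
        PathLE f h (s.natArr 4) x b ∧ f (s.nat 3) x ≤ b ∧ f (s.nat 3 + 2 ^ h) x ≤ b) ∧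
      (PathLE g h (s'.natArr 5) x b ↔ PathLE g h (s.natArr 5) x b ∧ g (s.nat 3) x ≤ b) ∧
      (PathLE g h (s'.natArr 6) x b ↔ PathLE g h (s.natArr 6) x b ∧ g (s.nat 3 + 2 ^ h) x ≤ b)) ∧
      (∀ a', s.realArr 2 a' ≤ s'.realArr 2 a') ∧
      ∀ a' b, 0 ≤ b → (s'.realArr 2 a' ≤ b ↔ s.realArr 2 a' ≤ b ∧ (a = a' →
        PathLE f h (s'.natArr 4) x (b * √(u * u + v * v)) ∧
        (0 ≤ u' * u + v' * v → PathLE g h (s'.natArr 5) x b) ∧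
        (u' * u + v' * v ≤ 0 → PathLE g h (s'.natArr 6) x b))) := by
  obtain ⟨K1, h1⟩ := insertAll_runs
  obtain ⟨K2, h2⟩ := queryAll_runs
  refine ⟨K1 + (K2 + (Prog.ite (.realLE (.reg 1) (.cell 2 addr)) .skip
    (.storeReal 2 addr (.reg 1))).bound), fun h s f g lf lg hM hf hfs hg hgs a ha x hx hxM hxi
    u v u' v' hu' hv' hu hv hn => ?_⟩
  refine Runs.mono (Runs.seq (T := K1 * (h + 1)) (T' := K2 * (h + 1) +
    (Prog.ite (.realLE (.reg 1) (.cell 2 addr)) .skip (.storeReal 2 addr (.reg 1))).bound) ?_) ?_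
    fun _ _ h => h
  swap
  · nlinarith [Nat.zero_le ((Prog.ite (.realLE (.reg 1) (.cell 2 addr)) .skip
      (.storeReal 2 addr (.reg 1))).bound * h)]
  refine (h1 h s f g lf lg hM hf hfs hg hgs).mono le_rfl fun s1 F1 H1 => ?_
  have a1 := (F1.nat 1 (by decide)).trans hM
  have a2 := F1.nat 2 (by decide)
  have a3 := F1.nat 3 (by decide)
  have aR : ∀ a, s1.realArr a = s.realArr a := fun a => F1.realArr a (by
    simp [insertAll, insertAt, insertProg, insertBody, insertLoad, insertSwap, insertMove,
      Prog.realArrs])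
  have aN0 := F1.natArr 0 (by decide)
  have aN1 := F1.natArr 1 (by decide)
  have aN3 := F1.natArr 3 (by decide)
  refine Runs.seq ((h2 h s1 f g lf lg a1 (hf.congr (fun a _ => aR a) aN1)
    (hg.congr (fun a _ => aR a) aN1) x (by rw [a3, aN3, hx]) hxM (by rw [aN1, a3, hxi]) u v u' v'
    (by rw [a3, aR, hu']) (by rw [a3, aR, hv']) (by rw [a3, aR, hu]) (by rw [a3, aR, hv])
    hn).mono le_rfl fun s2 F2 H2 => ?_)
  have b2 := (F2.nat 2 (by decide)).trans a2
  have b3 := (F2.nat 3 (by decide)).trans a3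
  have bN : s2.natArr = s1.natArr := funext fun a => F2.natArr a (by
    simp [queryAll, queryProg, queryBody, raiseIf, Prog.natArrs])
  have bR : s2.realArr 2 = s.realArr 2 := (F2.realArr 2 (by decide)).trans (aR 2)
  have haddr := ha s2 b2 b3 (by rw [bN, aN0])
  refine Runs.of_run rfl ?_
  by_cases hc : s2.real 1 ≤ s.realArr 2 a
  · have : (Prog.ite (.realLE (.reg 1) (.cell 2 addr)) .skip
        (.storeReal 2 addr (.reg 1))).run s2 = s2 := by
      simp [Prog.run, Test.Holds, RExp.eval, haddr, bR, hc]
    rw [this, bN, bR]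
    refine ⟨H1, fun _ => le_rfl, fun a' b hb => ?_⟩
    rw [← H2 b hb]
    refine ⟨fun h' => ⟨h', ?_⟩, fun h' => h'.1⟩
    rintro rfl
    exact hc.trans h'
  · have : (Prog.ite (.realLE (.reg 1) (.cell 2 addr)) .skip
        (.storeReal 2 addr (.reg 1))).run s2 = s2.storeReal 2 a (s2.real 1) := by
      simp [Prog.run, Test.Holds, RExp.eval, haddr, bR, hc]
    rw [this]
    simp only [storeReal_natArr, bN, storeReal_realArr, if_true, bR]
    refine ⟨H1, fun a' => ?_, fun a' b hb => ?_⟩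
    · by_cases haa : a' = a
      · rw [haa, Function.update_self]; exact (not_le.1 hc).le
      · rw [Function.update_of_ne haa]
    rw [← H2 b hb]
    by_cases haa : a' = a
    · subst haa
      rw [Function.update_self]
      exact ⟨fun h' => ⟨(not_le.1 hc).le.trans h', fun _ => h'⟩, fun h' => h'.2 rfl⟩
    · rw [Function.update_of_ne haa]
      exact ⟨fun h' => ⟨h', fun h'' => absurd h''.symm haa⟩, fun h' => h'.1⟩

theorem forall_lt_succ_iff {p : ℕ → Prop} {k : ℕ} :
    (∀ c < k + 1, p c) ↔ (∀ c < k, p c) ∧ p k :=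
  ⟨fun H => ⟨fun c hc => H c (by omega), H k (by omega)⟩, fun H c hc => by
    rcases Nat.lt_succ_iff_lt_or_eq.1 hc with h | rfl
    exacts [H.1 c h, H.2]⟩

/-- Insert the first `count` vectors one by one, each time raising a cell of the output. -/
def sweepLoop (count addr : NExp) : Prog := .forLoop 3 count (sweepBody addr)

/-- The trees hold the functions with numbers below `k`, and those of the opposite vectors. -/
def TreesHold (f g : ℕ → ℕ → ℝ) (h k : ℕ) (s : State) : Prop :=
  ∀ x < 2 ^ h, ∀ b : ℝ, 0 ≤ b →
    (PathLE f h (s.natArr 4) x b ↔ ∀ c < k, f c x ≤ b ∧ f (c + 2 ^ h) x ≤ b) ∧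
    (PathLE g h (s.natArr 5) x b ↔ ∀ c < k, g c x ≤ b) ∧
    (PathLE g h (s.natArr 6) x b ↔ ∀ c < k, g (c + 2 ^ h) x ≤ b)

theorem sweepLoop_runs (count addr : NExp) : ∃ K, ∀ (h : ℕ) (s : State) (f g : ℕ → ℕ → ℝ)
    (lf lg : ℕ → ℕ → ℕ → Prop), s.nat 1 = 2 ^ h → crossFam.Denotes s f lf →
    SingleCrossing f lf (2 ^ h) → stepFam.Denotes s g lg → SingleCrossing g lg (2 ^ h) →
    TreesHold f g h 0 s → ∀ m ≤ 2 ^ h,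
    (∀ s', s'.nat 2 = s.nat 2 → s'.nat 0 = s.nat 0 → count.eval s' = m) → ∀ ad : ℕ → ℕ,
    (∀ s', s'.nat 2 = s.nat 2 → s'.natArr 0 = s.natArr 0 → addr.eval s' = ad (s'.nat 3)) →
    ∀ pos : ℕ → ℕ, (∀ c < m, s.natArr 3 c = pos c ∧ pos c < 2 ^ h ∧ s.natArr 1 (pos c) = c) →
    ∀ u v u' v' : ℕ → ℝ, s.realArr 3 = u' → s.realArr 4 = v' → s.realArr 5 = u →
    s.realArr 6 = v → (∀ c < m, 0 < √(u c * u c + v c * v c)) →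
    Runs (sweepLoop count addr) s (K * (2 ^ h * (h + 1))) fun s' =>
      (∀ a, s.realArr 2 a ≤ s'.realArr 2 a) ∧ ∀ a b, 0 ≤ b →
      (s'.realArr 2 a ≤ b ↔ s.realArr 2 a ≤ b ∧ ∀ c < m, ad c = a →
        (∀ k < c + 1, f k (pos c) ≤ b * √(u c * u c + v c * v c) ∧
          f (k + 2 ^ h) (pos c) ≤ b * √(u c * u c + v c * v c)) ∧
        (0 ≤ u' c * u c + v' c * v c → ∀ k < c + 1, g k (pos c) ≤ b) ∧
        (u' c * u c + v' c * v c ≤ 0 → ∀ k < c + 1, g (k + 2 ^ h) (pos c) ≤ b)) := by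
  obtain ⟨K, hK⟩ := sweepBody_runs addr
  refine ⟨2 * (K + count.cost + 10), fun h s f g lf lg hM hf hfs hg hgs hT m hm hcount ad had pos
    hpos u v u' v' hu' hv' hu hv hn => ?_⟩
  have fr : ∀ {s'}, Frame (sweepLoop count addr) s s' → s'.nat 0 = s.nat 0 ∧ s'.nat 1 = s.nat 1 ∧
      s'.nat 2 = s.nat 2 ∧ s'.natArr 0 = s.natArr 0 ∧ s'.natArr 1 = s.natArr 1 ∧
      s'.natArr 3 = s.natArr 3 ∧ ∀ a, a ≠ 2 → s'.realArr a = s.realArr a := fun hF =>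
    ⟨hF.nat 0 (of_decide_eq_true rfl), hF.nat 1 (of_decide_eq_true rfl), hF.nat 2 (of_decide_eq_true rfl), hF.natArr 0 (of_decide_eq_true rfl),
      hF.natArr 1 (of_decide_eq_true rfl), hF.natArr 3 (of_decide_eq_true rfl), fun a ha => hF.realArr a (by
        simp [sweepLoop, Prog.forLoop, sweepBody, queryAll, queryProg, queryBody, raiseIf,
          insertAll, insertAt, insertProg, insertBody, insertLoad, insertSwap, insertMove,
          Prog.realArrs, ha])⟩
  have hloop := Runs.forLoop (c := 3) (bd := count) (body := sweepBody addr) (s₀ := s) (N := m)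
    (T := K * (h + 1)) (fun k s' => TreesHold f g h k s' ∧
      (∀ a, s.realArr 2 a ≤ s'.realArr 2 a) ∧ ∀ a b, 0 ≤ b →
      (s'.realArr 2 a ≤ b ↔ s.realArr 2 a ≤ b ∧ ∀ c < k, ad c = a →
        (∀ k < c + 1, f k (pos c) ≤ b * √(u c * u c + v c * v c) ∧
          f (k + 2 ^ h) (pos c) ≤ b * √(u c * u c + v c * v c)) ∧
        (0 ≤ u' c * u c + v' c * v c → ∀ k < c + 1, g k (pos c) ≤ b) ∧
        (u' c * u c + v' c * v c ≤ 0 → ∀ k < c + 1, g (k + 2 ^ h) (pos c) ≤ b)))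
    (of_decide_eq_true rfl) ?_ ?_ ?_
  · refine Runs.mono hloop ?_ fun _ _ H => H.2
    have h1 : 1 ≤ 2 ^ h := Nat.one_le_two_pow
    calc (m + 1) * (K * (h + 1) + count.cost + 10)
        ≤ (2 * 2 ^ h) * ((K + count.cost + 10) * (h + 1)) := by
          apply Nat.mul_le_mul
          · omega
          · nlinarith [Nat.zero_le (count.cost * h)]
      _ = _ := by ring
  · intro s' hF
    obtain ⟨e0, e1, e2, -⟩ := fr hF
    exact hcount s' e2 e0
  · exact ⟨hT, by simp⟩
  · rintro k hk s' hF h3 ⟨hT', hmono, hO⟩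
    obtain ⟨e0, e1, e2, eN0, eN1, eN3, eR⟩ := fr hF
    obtain ⟨p1, p2, p3⟩ := hpos k hk
    refine (hK h s' f g lf lg (e1.trans hM) (hf.congr eR eN1) hfs (hg.congr eR eN1) hgs (ad k)
      (fun s'' q2 q3 qN => by rw [had s'' (q2.trans e2) (qN.trans eN0), q3, h3]) (pos k)
      (by rw [eN3, h3, p1]) p2 (by rw [eN1, h3, p3]) (u k) (v k) (u' k) (v' k)
      (by rw [eR 3 (by norm_num), hu', h3]) (by rw [eR 4 (by norm_num), hv', h3])
      (by rw [eR 5 (by norm_num), hu, h3]) (by rw [eR 6 (by norm_num), hv, h3])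
      (hn k hk)).mono le_rfl ?_
    rintro s'' - ⟨H1, H3, H2⟩
    have hT'' : TreesHold f g h (k + 1) s'' := by
      intro x hx b hb
      obtain ⟨t1, t2, t3⟩ := hT' x hx b hb
      obtain ⟨r1, r2, r3⟩ := H1 x hx b
      rw [h3] at r1 r2 r3
      rw [r1, r2, r3, t1, t2, t3, forall_lt_succ_iff, forall_lt_succ_iff, forall_lt_succ_iff]
      exact ⟨Iff.rfl, Iff.rfl, Iff.rfl⟩
    refine ⟨hT'', fun a => (hmono a).trans (H3 a), fun a b hb => ?_⟩
    simp only [setNat_realArr]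
    rw [H2 a b hb, hO a b hb, forall_lt_succ_iff, and_assoc,
      (hT'' _ p2 _ (mul_nonneg hb (hn k hk).le)).1, (hT'' _ p2 b hb).2.1, (hT'' _ p2 b hb).2.2]

/-! ### Preparation of a sweep -/

/-- Store the vector from the base point `nat 2` to the point `j`, the opposite vector, and the
normalized direction. -/
def vecInit (j : NExp) : Prog :=
  .seq (.seq (.storeReal 3 (.reg 3) (.sub (.cell 0 j) (.cell 0 (.reg 2)))) <|
  .seq (.storeReal 4 (.reg 3) (.sub (.cell 1 j) (.cell 1 (.reg 2)))) <|
  .seq (.storeReal 3 (.add (.reg 3) (.reg 1)) (.sub (.cell 0 (.reg 2)) (.cell 0 j))) <|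
  .storeReal 4 (.add (.reg 3) (.reg 1)) (.sub (.cell 1 (.reg 2)) (.cell 1 j))) <|
  .ite (.conj (.realLE (.cell 4 (.reg 3)) (.const 0)) (.realLE (.const 0) (.cell 4 (.reg 3))))
    (.seq (.storeReal 5 (.reg 3) (.const 1)) (.storeReal 6 (.reg 3) (.const 0)))
    (.seq (.storeReal 5 (.reg 3) (.div (.cell 3 (.reg 3)) (.cell 4 (.reg 3))))
      (.storeReal 6 (.reg 3) (.const 1)))

/-- The first `k` vectors `(qx, qy)`, their opposites, and their directions are stored. -/
def VecsStored (qx qy : ℕ → ℝ) (M k : ℕ) (s : State) : Prop :=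
  ∀ c < k, s.realArr 3 c = qx c ∧ s.realArr 4 c = qy c ∧ s.realArr 3 (c + M) = -qx c ∧
    s.realArr 4 (c + M) = -qy c ∧ IsDir (s.realArr 5 c) (s.realArr 6 c) ∧
    ∃ l : ℝ, qx c = l * s.realArr 5 c ∧ qy c = l * s.realArr 6 c

theorem vecInit_runs (j : NExp) : ∃ K, ∀ (s : State) (M : ℕ) (jd : ℕ → ℕ), s.nat 1 = M →
    (∀ s', s'.nat 2 = s.nat 2 → j.eval s' = jd (s'.nat 3)) →
    Runs (.forLoop 3 (.reg 1) (vecInit j)) s (K * (M + 1)) fun s' => VecsStored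
      (fun c => s.realArr 0 (jd c) - s.realArr 0 (s.nat 2))
      (fun c => s.realArr 1 (jd c) - s.realArr 1 (s.nat 2)) M M s' := by
  refine ⟨(vecInit j).bound + 11, fun s M jd hM hj => ?_⟩
  refine (Runs.forLoop (c := 3) (bd := .reg 1) (N := M) (T := (vecInit j).bound) (fun k s' => VecsStored
      (fun c => s.realArr 0 (jd c) - s.realArr 0 (s.nat 2))
      (fun c => s.realArr 1 (jd c) - s.realArr 1 (s.nat 2)) M k s') (of_decide_eq_true rfl)
      (fun s' hF => (hF.nat 1 (by simp [Prog.forLoop, vecInit, Prog.natRegs])).trans hM) ?_ ?_).mono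
      (by simp only [NExp.cost]; nlinarith) fun _ _ h => h
  · intro c hc; omega
  · intro k hk s' hF h3 hI
    refine Runs.of_run rfl ?_
    have e1 : s'.nat 1 = M := (hF.nat 1 (by simp [Prog.forLoop, vecInit, Prog.natRegs])).trans hM
    have e2 : s'.nat 2 = s.nat 2 := hF.nat 2 (by simp [Prog.forLoop, vecInit, Prog.natRegs])
    have eX : s'.realArr 0 = s.realArr 0 :=
      hF.realArr 0 (by simp [Prog.forLoop, vecInit, Prog.realArrs])
    have eY : s'.realArr 1 = s.realArr 1 :=
      hF.realArr 1 (by simp [Prog.forLoop, vecInit, Prog.realArrs])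
    obtain ⟨x, hx⟩ : ∃ x, x = s.realArr 0 (jd k) - s.realArr 0 (s.nat 2) := ⟨_, rfl⟩
    obtain ⟨y, hy⟩ : ∃ y, y = s.realArr 1 (jd k) - s.realArr 1 (s.nat 2) := ⟨_, rfl⟩
    obtain ⟨s1, hs1⟩ : ∃ s1, s1 = (((s'.storeReal 3 k x).storeReal 4 k y).storeReal 3 (k + M)
      (-x)).storeReal 4 (k + M) (-y) := ⟨_, rfl⟩
    obtain ⟨D, E, hDE, l, hlx, hly, hrun⟩ : ∃ D E : ℝ, IsDir D E ∧ ∃ l, x = l * D ∧ y = l * E ∧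
        (vecInit j).run s' = (s1.storeReal 5 k D).storeReal 6 k E := by
      have hrun : ∀ P : Prog, (Prog.seq (.seq (.storeReal 3 (.reg 3)
            (.sub (.cell 0 j) (.cell 0 (.reg 2)))) <|
          .seq (.storeReal 4 (.reg 3) (.sub (.cell 1 j) (.cell 1 (.reg 2)))) <|
          .seq (.storeReal 3 (.add (.reg 3) (.reg 1)) (.sub (.cell 0 (.reg 2)) (.cell 0 j))) <|
          .storeReal 4 (.add (.reg 3) (.reg 1)) (.sub (.cell 1 (.reg 2)) (.cell 1 j))) P).run s' =
          P.run s1 := by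
        intro P
        simp [Prog.run, RExp.eval, NExp.eval, hj, e1, e2, h3, eX, eY, hs1, hx, hy]
      have h13 : s1.nat 3 = k := by simp [hs1, h3]
      have hM0 : M ≠ 0 := by omega
      have h14 : s1.realArr 4 k = y := by simp [hs1, hM0]
      have h1x : s1.realArr 3 k = x := by simp [hs1, hM0]
      by_cases hy0 : y = 0
      · refine ⟨1, 0, Or.inr ⟨rfl, rfl⟩, x, by ring, by rw [hy0]; ring, ?_⟩
        rw [vecInit, hrun]
        simp [Prog.run, Test.Holds, RExp.eval, NExp.eval, h13, h14, hy0]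
      · refine ⟨x / y, 1, Or.inl rfl, y, by field_simp, by ring, ?_⟩
        rw [vecInit, hrun]
        have : ¬ (y ≤ 0 ∧ 0 ≤ y) := fun h => hy0 (le_antisymm h.1 h.2)
        simp [Prog.run, Test.Holds, RExp.eval, NExp.eval, h13, h14, h1x, this]
    rw [hrun]
    intro c hc
    by_cases hck : c = k
    · subst hck
      have hM0 : M ≠ 0 := by omega
      refine ⟨by simp [hs1, hM0, hx], by simp [hs1, hM0, hy], by simp [hs1, hx], by simp [hs1, hy],
        by simpa using hDE, l, by simpa using hx ▸ hlx, by simpa using hy ▸ hly⟩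
    · obtain ⟨c1, c2, c3, c4, c5, c6⟩ := hI c (by omega)
      have h1 : c + M ≠ k := by omega
      have h2 : c ≠ k + M := by omega
      simp [hs1, hck, h1, h2, c1, c2, c3, c4, c5]
      simpa using c6

/-- Initialize the array that is to be sorted and clear the trees. -/
def natInit : Prog :=
  .seq (.storeNat 1 (.reg 3) (.reg 3)) <|
  .seq (.storeNat 4 (.reg 3) (.const 0)) <|
  .seq (.storeNat 4 (.add (.reg 3) (.reg 1)) (.const 0)) <|
  .seq (.storeNat 5 (.reg 3) (.const 0)) <|
  .seq (.storeNat 5 (.add (.reg 3) (.reg 1)) (.const 0)) <|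
  .seq (.storeNat 6 (.reg 3) (.const 0)) <|
  .storeNat 6 (.add (.reg 3) (.reg 1)) (.const 0)

theorem natInit_runs : ∃ K, ∀ (s : State) (M : ℕ), s.nat 1 = M →
    Runs (.forLoop 3 (.reg 1) natInit) s (K * (M + 1)) fun s' => ∀ c < M, s'.natArr 1 c = c ∧
      ∀ t ∈ [4, 5, 6], s'.natArr t c = 0 ∧ s'.natArr t (c + M) = 0 := by
  refine ⟨natInit.bound + 11, fun s M hM => ?_⟩
  refine (Runs.forLoop (c := 3) (bd := .reg 1) (N := M) (T := natInit.bound) (fun k s' => ∀ c < k, s'.natArr 1 c = c ∧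
      ∀ t ∈ [4, 5, 6], s'.natArr t c = 0 ∧ s'.natArr t (c + M) = 0) (by decide)
      (fun s' hF => (hF.nat 1 (by decide)).trans hM) ?_ ?_).mono
      (by simp only [NExp.cost]; nlinarith) fun _ _ h => h
  · intro c hc; omega
  · intro k hk s' hF h3 hI
    refine Runs.of_run rfl ?_
    have e1 : s'.nat 1 = M := (hF.nat 1 (by decide)).trans hM
    intro c hc
    by_cases hck : c = k
    · subst hck
      have hM0 : M ≠ 0 := by omega
      simp [natInit, Prog.run, NExp.eval, h3, e1, hM0]
    · have := hI c (by omega)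
      have h1 : c + M ≠ k := by omega
      have h2 : c ≠ k + M := by omega
      simpa [natInit, Prog.run, NExp.eval, h3, e1, hck, h1, h2] using this

/-- Store the inverse of the enumeration in the array `1` in the array `3`. -/
def posLoop : Prog := .forLoop 5 (.reg 1) (.storeNat 3 (.cell 1 (.reg 5)) (.reg 5))

theorem posLoop_runs : ∃ K, ∀ (s : State) (M : ℕ), s.nat 1 = M → IsEnum M (s.natArr 1) →
    Runs posLoop s (K * (M + 1)) fun s' => ∀ c < M, s'.natArr 3 c < M ∧
      s.natArr 1 (s'.natArr 3 c) = c := by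
  refine ⟨(Prog.storeNat 3 (.cell 1 (.reg 5)) (.reg 5)).bound + 11, fun s M hM hE => ?_⟩
  refine (Runs.forLoop (c := 5) (bd := .reg 1) (N := M) (T := (Prog.storeNat 3 (.cell 1 (.reg 5)) (.reg 5)).bound)
    (fun k s' => ∀ x < k, s'.natArr 3 (s.natArr 1 x) < k ∧
      s.natArr 1 (s'.natArr 3 (s.natArr 1 x)) = s.natArr 1 x) (by decide)
      (fun s' hF => (hF.nat 1 (by decide)).trans hM) ?_ ?_).mono
      (by simp only [NExp.cost]; nlinarith) fun s' _ H c hc => ?_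
  · intro c hc; omega
  · intro k hk s' hF h5 hI
    refine Runs.of_run rfl ?_
    have eN : s'.natArr 1 = s.natArr 1 := hF.natArr 1 (by decide)
    intro x hx
    by_cases hxk : s.natArr 1 x = s.natArr 1 k
    · simp [Prog.run, NExp.eval, h5, eN, hxk]
    · have := hI x (by
        rcases Nat.lt_succ_iff_lt_or_eq.1 hx with h | rfl
        exacts [h, absurd rfl hxk])
      simp only [Prog.run, NExp.eval, h5, eN, setNat_natArr, storeNat_natArr, if_true,
        Function.update_of_ne hxk]
      exact ⟨by omega, this.2⟩
  · obtain ⟨x, hx, rfl⟩ := hE.surj c hc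
    exact H x hx

/-- The comparison of the directions with numbers `i` and `j`. -/
def dirTest (i j : NExp) : Test :=
  .realLE (.mul (.cell 5 i) (.cell 6 j)) (.mul (.cell 5 j) (.cell 6 i))

/-- All points among the first `c + 1` vectors `(qx, qy)` have distance at most `b` from the ray
spanned by the `c`-th vector. -/
def RayLE (qx qy : ℕ → ℝ) (c : ℕ) (b : ℝ) : Prop :=
  ∀ k < c + 1, |qx k * qy c - qy k * qx c| ≤ b * √(qx c * qx c + qy c * qy c) ∧
    (qx k * qx c + qy k * qy c ≤ 0 → √(qx k * qx k + qy k * qy k) ≤ b)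

/-- The distance from a ray in terms of the representative `(u, v)` of the direction of its line. -/
theorem ray_iff {x y x' y' l u v b : ℝ} (hn : 0 < √(u * u + v * v))
    (hx : x' = l * u) (hy : y' = l * v) :
    ((x * v - y * u ≤ b * √(u * u + v * v) ∧ -x * v - -y * u ≤ b * √(u * u + v * v)) ∧
      (0 ≤ x' * u + y' * v → x * u + y * v ≤ 0 → √(x * x + y * y) ≤ b) ∧
      (x' * u + y' * v ≤ 0 → -x * u + -y * v ≤ 0 → √(x * x + y * y) ≤ b)) ↔
    (|x * y' - y * x'| ≤ b * √(x' * x' + y' * y') ∧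
      (x * x' + y * y' ≤ 0 → √(x * x + y * y) ≤ b)) := by
  have hpos : 0 < u * u + v * v := Real.sqrt_pos.1 hn
  have habs : (x * v - y * u ≤ b * √(u * u + v * v) ∧ -x * v - -y * u ≤ b * √(u * u + v * v)) ↔
      |x * v - y * u| ≤ b * √(u * u + v * v) := by
    rw [abs_le']
    refine and_congr_right fun _ => ?_
    rw [show -x * v - -y * u = -(x * v - y * u) by ring]
  rw [habs]
  have e1 : x * y' - y * x' = l * (x * v - y * u) := by rw [hx, hy]; ring
  have e2 : √(x' * x' + y' * y') = |l| * √(u * u + v * v) := by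
    rw [show x' * x' + y' * y' = l ^ 2 * (u * u + v * v) by rw [hx, hy]; ring,
      Real.sqrt_mul (sq_nonneg l), Real.sqrt_sq_eq_abs]
  have e3 : x' * u + y' * v = l * (u * u + v * v) := by rw [hx, hy]; ring
  have e4 : x * x' + y * y' = l * (x * u + y * v) := by rw [hx, hy]; ring
  have e5 : -x * u + -y * v = -(x * u + y * v) := by ring
  rw [e1, e2, e3, e4, e5, abs_mul, show b * (|l| * √(u * u + v * v)) =
    |l| * (b * √(u * u + v * v)) by ring]
  rcases lt_trichotomy l 0 with hl | rfl | hl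
  · have h1 : ¬ 0 ≤ l * (u * u + v * v) := not_le.2 (mul_neg_of_neg_of_pos hl hpos)
    have h2 : l * (u * u + v * v) ≤ 0 := (not_le.1 h1).le
    rw [mul_le_mul_iff_right₀ (abs_pos.2 hl.ne)]
    have h3 : -(x * u + y * v) ≤ 0 ↔ l * (x * u + y * v) ≤ 0 := by
      rw [neg_nonpos, mul_nonpos_iff]
      constructor
      · intro h; right; exact ⟨hl.le, h⟩
      · rintro (h | h)
        · linarith
        · exact h.2
    rw [h3]
    tauto
  · simp only [abs_zero, zero_mul, le_refl, true_and, forall_const]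
    constructor
    · rintro ⟨-, h1, h2⟩
      rcases le_total (x * u + y * v) 0 with h | h
      · exact h1 h
      · exact h2 (by linarith)
    · intro h
      refine ⟨?_, fun _ => h, fun _ => h⟩
      -- The Cauchy–Schwarz inequality.
      have h1 : |x * v - y * u| ≤ √(x * x + y * y) * √(u * u + v * v) := by
        rw [← Real.sqrt_mul (add_nonneg (mul_self_nonneg x) (mul_self_nonneg y))]
        refine Real.abs_le_sqrt ?_
        nlinarith [sq_nonneg (x * u + y * v)]
      exact h1.trans (mul_le_mul_of_nonneg_right h hn.le)
  · have h1 : 0 ≤ l * (u * u + v * v) := (mul_pos hl hpos).le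
    have h2 : ¬ l * (u * u + v * v) ≤ 0 := not_le.2 (mul_pos hl hpos)
    rw [mul_le_mul_iff_right₀ (abs_pos.2 hl.ne')]
    have h3 : x * u + y * v ≤ 0 ↔ l * (x * u + y * v) ≤ 0 := by
      rw [mul_nonpos_iff]
      constructor
      · intro h; left; exact ⟨hl.le, h⟩
      · rintro (h | h)
        · exact h.2
        · linarith
    rw [h3]
    tauto

theorem stepVal_le_iff {a b c d : ℕ → ℝ} {k x : ℕ} {r : ℝ} (hr : 0 ≤ r) :
    stepVal a b c d k x ≤ r ↔ (a k * c x + b k * d x ≤ 0 → √(a k * a k + b k * b k) ≤ r) := by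
  unfold stepVal
  split_ifs with h <;> simp [h, hr]

/-- For all points `j` of a range, described by `count`, on one side of the base point `nat 2`,
raise the cell `addr` of the output to the maximal distance of the points between from the ray from
the base point to `j`. The expressions use the distance `nat 3` of the indices. -/
def sweep (j count addr : NExp) : Prog :=
  .seq (.forLoop 3 (.reg 1) (vecInit j)) <| .seq (.forLoop 3 (.reg 1) natInit) <|
  .seq (sortProg dirTest) <| .seq posLoop (sweepLoop count addr)

theorem sweep_runs (j count addr : NExp) : ∃ K, ∀ (h : ℕ) (s : State) (m : ℕ) (jd ad : ℕ → ℕ),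
    s.nat 1 = 2 ^ h → m ≤ 2 ^ h →
    (∀ s', s'.nat 2 = s.nat 2 → j.eval s' = jd (s'.nat 3)) →
    (∀ s', s'.nat 2 = s.nat 2 → s'.nat 0 = s.nat 0 → count.eval s' = m) →
    (∀ s', s'.nat 2 = s.nat 2 → s'.natArr 0 = s.natArr 0 → addr.eval s' = ad (s'.nat 3)) →
    jd 0 = s.nat 2 →
    Runs (sweep j count addr) s (K * (2 ^ h * (h + 1))) fun s' =>
      (∀ a, s.realArr 2 a ≤ s'.realArr 2 a) ∧ ∀ a b, 0 ≤ b →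
      (s'.realArr 2 a ≤ b ↔ s.realArr 2 a ≤ b ∧ ∀ c < m, ad c = a →
        RayLE (fun c => s.realArr 0 (jd c) - s.realArr 0 (s.nat 2))
          (fun c => s.realArr 1 (jd c) - s.realArr 1 (s.nat 2)) c b) := by
  obtain ⟨K1, h1⟩ := vecInit_runs j
  obtain ⟨K2, h2⟩ := natInit_runs
  obtain ⟨K3, h3⟩ := sortProg_runs dirTest
  obtain ⟨K4, h4⟩ := posLoop_runs
  obtain ⟨K5, h5⟩ := sweepLoop_runs count addr
  refine ⟨2 * K1 + 2 * K2 + K3 + 2 * K4 + K5, fun h s m jd ad hM hm hj hcount had hj0 => ?_⟩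
  refine Runs.mono (T := K1 * (2 ^ h + 1) + (K2 * (2 ^ h + 1) + (K3 * (2 ^ h * (h + 1)) +
    (K4 * (2 ^ h + 1) + K5 * (2 ^ h * (h + 1)))))) ?_ ?_ fun _ _ h => h
  swap
  · have hpos : 1 ≤ 2 ^ h := Nat.one_le_two_pow
    have hb : 2 ^ h + 1 ≤ 2 * (2 ^ h * (h + 1)) := by nlinarith [Nat.zero_le (2 ^ h * h)]
    have b1 := Nat.mul_le_mul_left K1 hb
    have b2 := Nat.mul_le_mul_left K2 hb
    have b4 := Nat.mul_le_mul_left K4 hb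
    linarith
  obtain ⟨qx, hqx⟩ : ∃ qx, qx = fun c => s.realArr 0 (jd c) - s.realArr 0 (s.nat 2) := ⟨_, rfl⟩
  obtain ⟨qy, hqy⟩ : ∃ qy, qy = fun c => s.realArr 1 (jd c) - s.realArr 1 (s.nat 2) := ⟨_, rfl⟩
  rw [← hqx, ← hqy]
  refine Runs.seq ((h1 s (2 ^ h) jd hM hj).mono le_rfl fun s1 F1 H1 => ?_)
  rw [← hqx, ← hqy] at H1
  have a0 : s1.nat 0 = s.nat 0 := F1.nat 0 (of_decide_eq_true rfl)
  have a1 : s1.nat 1 = 2 ^ h := (F1.nat 1 (of_decide_eq_true rfl)).trans hM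
  have a2 : s1.nat 2 = s.nat 2 := F1.nat 2 (of_decide_eq_true rfl)
  have aR : s1.realArr 2 = s.realArr 2 := F1.realArr 2 (of_decide_eq_true rfl)
  have aN : s1.natArr 0 = s.natArr 0 := F1.natArr 0 (of_decide_eq_true rfl)
  refine Runs.seq ((h2 s1 (2 ^ h) a1).mono le_rfl fun s2 F2 H2 => ?_)
  have b0 : s2.nat 0 = s.nat 0 := (F2.nat 0 (by decide)).trans a0
  have b1 : s2.nat 1 = 2 ^ h := (F2.nat 1 (by decide)).trans a1
  have b2 : s2.nat 2 = s.nat 2 := (F2.nat 2 (by decide)).trans a2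
  have bR : s2.realArr = s1.realArr := funext fun a => F2.realArr a
    (by simp [Prog.forLoop, natInit, Prog.realArrs])
  have bN : s2.natArr 0 = s.natArr 0 := (F2.natArr 0 (by decide)).trans aN
  have hE : IsEnum (2 ^ h) (s2.natArr 1) :=
    ⟨fun x hx => by rw [(H2 x hx).1]; exact hx, fun c hc => ⟨c, hc, (H2 c hc).1⟩⟩
  have hD : ∀ c < 2 ^ h, IsDir (s1.realArr 5 c) (s1.realArr 6 c) := fun c hc => (H1 c hc).2.2.2.2.1
  refine Runs.seq ((h3 s2 h (fun i k => s1.realArr 5 i * s1.realArr 6 k ≤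
    s1.realArr 5 k * s1.realArr 6 i) b1 ?_ (fun c _ d _ => le_total _ _)
    (fun c hc d hd g hg => dir_trans (hD c hc) (hD d hd) (hD g hg)) hE).mono le_rfl
    fun s3 F3 ⟨hE3, H3⟩ => ?_)
  · intro s' hs' i k
    simp [dirTest, Test.Holds, RExp.eval, hs', bR]
  have c0 : s3.nat 0 = s.nat 0 := (F3.nat 0 (by decide)).trans b0
  have c1 : s3.nat 1 = 2 ^ h := (F3.nat 1 (by decide)).trans b1
  have c2 : s3.nat 2 = s.nat 2 := (F3.nat 2 (by decide)).trans b2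
  have cR : s3.realArr = s1.realArr := (funext fun a => F3.realArr a
    (by simp [sortProg, mergePass, Prog.forLoop, mergeReset, mergeTake, Prog.realArrs])).trans bR
  have cN : s3.natArr 0 = s.natArr 0 := (F3.natArr 0 (by decide)).trans bN
  refine Runs.seq ((h4 s3 (2 ^ h) c1 hE3).mono le_rfl fun s4 F4 H4 => ?_)
  have d0 : s4.nat 0 = s.nat 0 := (F4.nat 0 (by decide)).trans c0
  have d1 : s4.nat 1 = 2 ^ h := (F4.nat 1 (by decide)).trans c1
  have d2 : s4.nat 2 = s.nat 2 := (F4.nat 2 (by decide)).trans c2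
  have dR : s4.realArr = s1.realArr := (funext fun a => F4.realArr a
    (by simp [posLoop, Prog.forLoop, Prog.realArrs])).trans cR
  have dN : s4.natArr 0 = s.natArr 0 := (F4.natArr 0 (by decide)).trans cN
  have dN1 : s4.natArr 1 = s3.natArr 1 := F4.natArr 1 (by decide)
  have hdir : ∀ x < 2 ^ h, IsDir (s4.realArr 5 (s4.natArr 1 x)) (s4.realArr 6 (s4.natArr 1 x)) := by
    intro x hx
    rw [dR, dN1]
    exact hD _ (hE3.lt x hx)
  have hsort : ∀ x y, x ≤ y → y < 2 ^ h → s4.realArr 5 (s4.natArr 1 x) *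
      s4.realArr 6 (s4.natArr 1 y) ≤ s4.realArr 5 (s4.natArr 1 y) *
      s4.realArr 6 (s4.natArr 1 x) := by
    rw [dR, dN1]
    exact H3
  have hnorm : ∀ c < m, 0 < √(s1.realArr 5 c * s1.realArr 5 c + s1.realArr 6 c * s1.realArr 6 c) := by
    intro c hc
    apply Real.sqrt_pos.2
    rcases hD c (by omega) with e | ⟨e, -⟩
    · rw [e]; nlinarith [mul_self_nonneg (s1.realArr 5 c)]
    · rw [e]; nlinarith [mul_self_nonneg (s1.realArr 6 c)]
  have htree : ∀ t ∈ [4, 5, 6], ∀ v < 2 ^ h + 2 ^ h, s4.natArr t v = 0 := by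
    intro t ht v hv
    have e : s4.natArr t = s2.natArr t := by
      simp only [List.mem_cons, List.not_mem_nil, or_false] at ht
      rcases ht with rfl | rfl | rfl <;>
        exact (F4.natArr _ (by decide)).trans (F3.natArr _ (by decide))
    rw [e]
    by_cases hv' : v < 2 ^ h
    · exact ((H2 v hv').2 t ht).1
    · have := ((H2 (v - 2 ^ h) (by omega)).2 t ht).2
      rwa [Nat.sub_add_cancel (by omega)] at this
  have hq0 : s1.realArr 3 0 = 0 ∧ s1.realArr 4 0 = 0 := by
    obtain ⟨e1, e2, -⟩ := H1 0 (by positivity)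
    rw [e1, e2, hqx, hqy]
    simp [hj0]
  have hzero : ∀ (f : ℕ → ℕ → ℝ) (t : ℕ), t ∈ [4, 5, 6] → (∀ x, f 0 x = 0) → ∀ x < 2 ^ h,
      ∀ b : ℝ, 0 ≤ b → PathLE f h (s4.natArr t) x b := by
    intro f t ht hf x hx b hb e _
    rw [htree t ht _ (lt_of_le_of_lt (Nat.div_le_self _ _) (by omega)), hf]
    exact hb
  refine (h5 h s4 _ _ _ _ d1 (crossFam_denotes s4) (crossVal_singleCrossing hdir hsort)
    (stepFam_denotes s4) (stepVal_singleCrossing hdir hsort) ?_ m hm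
    (fun s' e2 e0 => hcount s' (e2.trans d2) (e0.trans d0)) ad
    (fun s' e2 e0 => had s' (e2.trans d2) (e0.trans dN)) (s4.natArr 3)
    (fun c hc => ⟨rfl, (H4 c (by omega)).1, by rw [dN1]; exact (H4 c (by omega)).2⟩)
    (s1.realArr 5) (s1.realArr 6) (s1.realArr 3) (s1.realArr 4) (by rw [dR]) (by rw [dR])
    (by rw [dR]) (by rw [dR]) hnorm).mono le_rfl fun s5 _ ⟨H6, H5⟩ => ⟨fun a => ?_, fun a b hb => ?_⟩
  · intro x hx b hb
    have z1 := hzero (crossVal (s4.realArr 3) (s4.realArr 4)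
      (fun x => s4.realArr 5 (s4.natArr 1 x)) (fun x => s4.realArr 6 (s4.natArr 1 x))) 4 (by simp)
      (fun x => by simp [crossVal, dR, hq0]) x hx b hb
    have z2 := fun t ht => hzero (stepVal (s4.realArr 3) (s4.realArr 4)
      (fun x => s4.realArr 5 (s4.natArr 1 x)) (fun x => s4.realArr 6 (s4.natArr 1 x))) t ht
      (fun x => by simp [stepVal, dR, hq0]) x hx b hb
    exact ⟨iff_of_true z1 (by simp), iff_of_true (z2 5 (by simp)) (by simp),
      iff_of_true (z2 6 (by simp)) (by simp)⟩
  · rw [← aR, ← dR]; exact H6 a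
  · rw [H5 a b hb, dR, aR]
    refine and_congr_right fun _ => forall₃_congr fun c hc _ => ?_
    obtain ⟨e3, e4, -, -, -, l, hlx, hly⟩ := H1 c (by omega)
    have hpos : s4.natArr 1 (s4.natArr 3 c) = c := by rw [dN1]; exact (H4 c (by omega)).2
    unfold RayLE
    have key : ∀ k < c + 1, _ := fun k hk =>
      ray_iff (x := qx k) (y := qy k) (b := b) (hnorm c hc) hlx hly
    rw [← forall₂_congr key]
    simp only [stepVal_le_iff hb, crossVal, hpos, e3, e4]
    constructor
    · rintro ⟨g1, g2, g3⟩ k hk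
      obtain ⟨k1, k2, k3, k4, -⟩ := H1 k (by omega)
      have g1' := g1 k hk
      rw [k1, k2, k3, k4] at g1'
      refine ⟨g1', fun hd => ?_, fun hd => ?_⟩
      · have := g2 hd k hk
        rwa [k1, k2] at this
      · have := g3 hd k hk
        rwa [k3, k4, neg_mul_neg, neg_mul_neg] at this
    · intro g
      refine ⟨fun k hk => ?_, fun hd k hk => ?_, fun hd k hk => ?_⟩ <;>
        obtain ⟨k1, k2, k3, k4, -⟩ := H1 k (by omega)
      · rw [k1, k2, k3, k4]; exact (g k hk).1
      · rw [k1, k2]; exact (g k hk).2.1 hd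
      · rw [k3, k4, neg_mul_neg, neg_mul_neg]; exact (g k hk).2.2 hd

/-! ### The complete program -/

/-- Store in `nat 1` the least power of two that is at least `nat 0`. -/
def powProg : Prog :=
  .seq (.setNat 1 (.const 1)) <|
  .loop (.natLT (.reg 1) (.reg 0)) (.setNat 1 (.add (.reg 1) (.reg 1)))

theorem powProg_runs : ∃ K, ∀ s : State,
    Runs powProg s (K * (Nat.clog 2 (s.nat 0) + 1)) fun s' =>
      s'.nat 1 = 2 ^ Nat.clog 2 (s.nat 0) := by
  refine ⟨20, fun s => ?_⟩
  have hloop := Runs.loop (b := .natLT (.reg 1) (.reg 0))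
    (P := .setNat 1 (.add (.reg 1) (.reg 1))) (s₀ := s.setNat 1 1) (N := Nat.clog 2 (s.nat 0))
    (T := 4) (fun k s' => s'.nat 1 = 2 ^ k) (by simp) ?_ ?_
  · refine (Runs.step (P := .setNat 1 (.const 1)) rfl (by simpa [Prog.run, NExp.eval] using
      hloop)).mono ?_ fun _ _ h => h
    simp only [Prog.bound, NExp.cost, Test.cost]
    omega
  · intro k hk s' hF h1
    have h0 : s'.nat 0 = s.nat 0 := (hF.nat 0 (by decide)).trans (by simp)
    refine ⟨?_, Runs.of_run (P := .setNat 1 (.add (.reg 1) (.reg 1))) rfl ?_⟩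
    · simp only [Test.Holds, NExp.eval, h0, h1]
      exact fun h => absurd (Nat.clog_le_of_le_pow h) (not_le.2 hk)
    · simp [Prog.run, NExp.eval, h1, pow_succ, mul_two]
  · intro s' hF h1
    have h0 : s'.nat 0 = s.nat 0 := (hF.nat 0 (by decide)).trans (by simp)
    simp only [Test.Holds, NExp.eval, h0, h1, not_not]
    exact Nat.le_pow_clog (by norm_num) _

/-- Store the multiples `i * n` of `n = nat 0`, for `i < n`, in the array `0`. -/
def rowProg : Prog :=
  .seq (.setNat 20 (.const 0)) <|
  .forLoop 2 (.reg 0) (.seq (.storeNat 0 (.reg 2) (.reg 20))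
    (.setNat 20 (.add (.reg 20) (.reg 0))))

theorem rowProg_runs : ∃ K, ∀ s : State, Runs rowProg s (K * (s.nat 0 + 1)) fun s' =>
    ∀ i < s.nat 0, s'.natArr 0 i = i * s.nat 0 := by
  refine ⟨30, fun s => ?_⟩
  have hloop := Runs.forLoop (c := 2) (bd := .reg 0) (body := .seq (.storeNat 0 (.reg 2) (.reg 20))
    (.setNat 20 (.add (.reg 20) (.reg 0)))) (s₀ := s.setNat 20 0) (N := s.nat 0) (T := 7)
    (fun k s' => s'.nat 20 = k * s.nat 0 ∧ ∀ i < k, s'.natArr 0 i = i * s.nat 0) (by decide)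
    (fun s' hF => (hF.nat 0 (by decide)).trans (by simp)) (by simp) ?_
  · refine Runs.mono (Q := fun s' => s'.nat 20 = s.nat 0 * s.nat 0 ∧
      ∀ i < s.nat 0, s'.natArr 0 i = i * s.nat 0) (Runs.step (P := .setNat 20 (.const 0)) rfl
      (by simpa [Prog.run, NExp.eval] using hloop)) ?_ fun _ _ h => h.2
    simp only [Prog.bound, NExp.cost]
    omega
  · rintro k hk s' hF h2 ⟨h20, hI⟩
    have h0 : s'.nat 0 = s.nat 0 := (hF.nat 0 (by decide)).trans (by simp)
    refine Runs.of_run (P := .seq (.storeNat 0 (.reg 2) (.reg 20))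
      (.setNat 20 (.add (.reg 20) (.reg 0)))) rfl ⟨?_, fun i hi => ?_⟩
    · simp [Prog.run, NExp.eval, h0, h20]; ring
    · by_cases hik : i = k
      · simp [Prog.run, NExp.eval, h2, h20, hik]
      · simp [Prog.run, NExp.eval, h2, hik, hI i (by omega)]

/-- For the base point with index `nat 2`, the sweep towards larger indices. -/
def sweepUp : Prog :=
  sweep (.add (.reg 2) (.reg 3)) (.sub (.reg 0) (.reg 2))
    (.add (.cell 0 (.reg 2)) (.add (.reg 2) (.reg 3)))

/-- For the base point with index `nat 2`, the sweep towards smaller indices. -/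
def sweepDown : Prog :=
  sweep (.sub (.reg 2) (.reg 3)) (.add (.reg 2) (.const 1))
    (.add (.cell 0 (.sub (.reg 2) (.reg 3))) (.reg 2))

/-- The program that computes all Hausdorff distances. -/
def hausdorffProg : Prog :=
  .seq powProg <| .seq rowProg <| .forLoop 2 (.reg 0) (.seq sweepUp sweepDown)

theorem hausdorffProg_runs : ∃ K, ∀ (s : State) (n : ℕ) (X Y : ℕ → ℝ), s.nat 0 = n →
    s.realArr 0 = X → s.realArr 1 = Y → (∀ a, s.realArr 2 a = 0) →
    Runs hausdorffProg s (K * ((n + 1) * (2 ^ Nat.clog 2 n * (Nat.clog 2 n + 1)))) fun s' =>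
      (∀ a, 0 ≤ s'.realArr 2 a) ∧ ∀ a b, 0 ≤ b → (s'.realArr 2 a ≤ b ↔ ∀ i < n,
        (∀ c < n - i, i * n + (i + c) = a →
          RayLE (fun c => X (i + c) - X i) (fun c => Y (i + c) - Y i) c b) ∧
        (∀ c < i + 1, (i - c) * n + i = a →
          RayLE (fun c => X (i - c) - X i) (fun c => Y (i - c) - Y i) c b)) := by
  obtain ⟨K1, h1⟩ := powProg_runs
  obtain ⟨K2, h2⟩ := rowProg_runs
  obtain ⟨K3, h3⟩ := sweep_runs (.add (.reg 2) (.reg 3)) (.sub (.reg 0) (.reg 2))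
    (.add (.cell 0 (.reg 2)) (.add (.reg 2) (.reg 3)))
  obtain ⟨K4, h4⟩ := sweep_runs (.sub (.reg 2) (.reg 3)) (.add (.reg 2) (.const 1))
    (.add (.cell 0 (.sub (.reg 2) (.reg 3))) (.reg 2))
  refine ⟨K1 + K2 + K3 + K4 + 11, fun s n X Y hn hX hY hz => ?_⟩
  obtain ⟨h, hh⟩ : ∃ h, h = Nat.clog 2 n := ⟨_, rfl⟩
  rw [← hh]
  have hnM : n ≤ 2 ^ h := by rw [hh]; exact Nat.le_pow_clog (by norm_num) _
  refine Runs.mono (T := K1 * (h + 1) + (K2 * (n + 1) +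
    ((n + 1) * (K3 * (2 ^ h * (h + 1)) + K4 * (2 ^ h * (h + 1)) + (NExp.reg 0).cost + 10)))) ?_ ?_
    fun _ _ h => h
  swap
  · obtain ⟨A, hA⟩ : ∃ A, A = 2 ^ h * (h + 1) := ⟨_, rfl⟩
    have hpos : 1 ≤ 2 ^ h := Nat.one_le_two_pow
    have hA1 : h + 1 ≤ A := by rw [hA]; exact Nat.le_mul_of_pos_left _ hpos
    rw [← hA]
    have b1 : K1 * (h + 1) ≤ K1 * ((n + 1) * A) := Nat.mul_le_mul_left _
      (hA1.trans (Nat.le_mul_of_pos_left _ (by omega)))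
    have b2 : K2 * (n + 1) ≤ K2 * ((n + 1) * A) := Nat.mul_le_mul_left _
      (Nat.le_mul_of_pos_right _ (by omega))
    have b3 : (n + 1) * 11 ≤ 11 * ((n + 1) * A) := by
      rw [mul_comm]
      exact Nat.mul_le_mul_left _ (Nat.le_mul_of_pos_right _ (by omega))
    simp only [NExp.cost]
    nlinarith
  refine Runs.seq (Runs.mono (h1 s) (by rw [hn, hh]) fun s1 F1 H1 => ?_)
  have a0 : s1.nat 0 = n := (F1.nat 0 (by decide)).trans hn
  have aR : s1.realArr = s.realArr := funext fun a => F1.realArr a (by simp [powProg, Prog.realArrs])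
  refine Runs.seq (Runs.mono (h2 s1) (by rw [a0]) fun s2 F2 H2 => ?_)
  have b0 : s2.nat 0 = n := (F2.nat 0 (by decide)).trans a0
  have b1 : s2.nat 1 = 2 ^ h := (F2.nat 1 (by decide)).trans (by rw [H1, hn, hh])
  have bR : s2.realArr = s.realArr := (funext fun a => F2.realArr a
    (by simp [rowProg, Prog.forLoop, Prog.realArrs])).trans aR
  rw [a0] at H2
  refine Runs.forLoop (N := n) (fun k s' => (∀ a, 0 ≤ s'.realArr 2 a) ∧
      ∀ a b, 0 ≤ b → (s'.realArr 2 a ≤ b ↔ ∀ i < k,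
        (∀ c < n - i, i * n + (i + c) = a →
          RayLE (fun c => X (i + c) - X i) (fun c => Y (i + c) - Y i) c b) ∧
        (∀ c < i + 1, (i - c) * n + i = a →
          RayLE (fun c => X (i - c) - X i) (fun c => Y (i - c) - Y i) c b))) (by decide)
    (fun s' hF => (hF.nat 0 (by decide)).trans b0) ?_ ?_
  · refine ⟨fun a => by simp [bR, hz], fun a b hb => ?_⟩
    simp [bR, hz, hb]
  · rintro k hk s' hF hk2 ⟨hI0, hI⟩
    have c0 : s'.nat 0 = n := (hF.nat 0 (by decide)).trans b0
    have c1 : s'.nat 1 = 2 ^ h := (hF.nat 1 (by decide)).trans b1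
    have cX : s'.realArr 0 = X := (hF.realArr 0 (by decide)).trans (by rw [bR, hX])
    have cY : s'.realArr 1 = Y := (hF.realArr 1 (by decide)).trans (by rw [bR, hY])
    have cN : s'.natArr 0 = s2.natArr 0 := hF.natArr 0 (by decide)
    refine Runs.seq ((h3 h s' (n - k) (fun c => k + c) (fun c => k * n + (k + c)) c1 (by omega)
      (fun s'' e2 => by simp [NExp.eval, e2, hk2]) (fun s'' e2 e0 => by
        simp [NExp.eval, e2, hk2, e0, c0]) (fun s'' e2 eN => by
        simp [NExp.eval, e2, hk2, eN, cN, H2 k hk]) (by simp [hk2])).mono le_rfl fun s3 F3 ⟨H5, H3⟩ => ?_)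
    have d0 : s3.nat 0 = n := (F3.nat 0 (by decide)).trans c0
    have d1 : s3.nat 1 = 2 ^ h := (F3.nat 1 (by decide)).trans c1
    have d2 : s3.nat 2 = k := (F3.nat 2 (by decide)).trans hk2
    have dX : s3.realArr 0 = X := (F3.realArr 0 (by decide)).trans cX
    have dY : s3.realArr 1 = Y := (F3.realArr 1 (by decide)).trans cY
    have dN : s3.natArr 0 = s2.natArr 0 := (F3.natArr 0 (by decide)).trans cN
    refine (h4 h s3 (k + 1) (fun c => k - c) (fun c => (k - c) * n + k) d1 (by omega)
      (fun s'' e2 => by simp [NExp.eval, e2, d2]) (fun s'' e2 e0 => by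
        simp [NExp.eval, e2, d2]) (fun s'' e2 eN => by
        simp [NExp.eval, e2, d2, eN, dN, H2 (k - s''.nat 3) (by omega)])
        (by simp [d2])).mono le_rfl fun s4 _ ⟨H6, H4⟩ =>
        ⟨fun a => (hI0 a).trans ((H5 a).trans (H6 a)), fun a b hb => ?_⟩
    simp only [cX, cY, hk2] at H3
    simp only [dX, dY, d2] at H4
    simp only [setNat_realArr]
    rw [H4 a b hb, H3 a b hb, hI a b hb]
    exact and_assoc.trans forall_lt_succ_iff.symm

end RealRAM

/-! ### The Hausdorff distance between a segment and a subcurve -/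

/-- The distance of a point from a segment, in coordinates relative to the end points. It is
determined by the distances from the line and, behind each of the end points, from that point. -/
theorem infDist_segment_le_iff (a b q : EuclideanSpace ℝ (Fin 2)) (r : ℝ) :
    Metric.infDist q (segment ℝ a b) ≤ r ↔
      |(q 0 - a 0) * (b 1 - a 1) - (q 1 - a 1) * (b 0 - a 0)| ≤
        r * √((b 0 - a 0) * (b 0 - a 0) + (b 1 - a 1) * (b 1 - a 1)) ∧
      ((q 0 - a 0) * (b 0 - a 0) + (q 1 - a 1) * (b 1 - a 1) ≤ 0 →
        √((q 0 - a 0) * (q 0 - a 0) + (q 1 - a 1) * (q 1 - a 1)) ≤ r) ∧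
      ((q 0 - b 0) * (a 0 - b 0) + (q 1 - b 1) * (a 1 - b 1) ≤ 0 →
        √((q 0 - b 0) * (q 0 - b 0) + (q 1 - b 1) * (q 1 - b 1)) ≤ r) := by
  have hdist : ∀ y : EuclideanSpace ℝ (Fin 2), dist q y =
      √((q 0 - y 0) * (q 0 - y 0) + (q 1 - y 1) * (q 1 - y 1)) := by
    intro y
    rw [EuclideanSpace.dist_eq, Fin.sum_univ_two, Real.dist_eq, Real.dist_eq, sq_abs, sq_abs, sq, sq]
  have hseg : ∀ y, y ∈ segment ℝ a b ↔ ∃ t : ℝ, 0 ≤ t ∧ t ≤ 1 ∧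
      y 0 = a 0 + t * (b 0 - a 0) ∧ y 1 = a 1 + t * (b 1 - a 1) := by
    intro y
    rw [segment_eq_image']
    constructor
    · rintro ⟨t, ⟨h0, h1⟩, rfl⟩
      exact ⟨t, h0, h1, by simp, by simp⟩
    · rintro ⟨t, h0, h1, hx, hy⟩
      refine ⟨t, ⟨h0, h1⟩, ?_⟩
      ext i
      fin_cases i
      · simp [hx]
      · simp [hy]
  have hne : (segment ℝ a b).Nonempty := ⟨a, left_mem_segment ℝ a b⟩
  have hcomp : IsCompact (segment ℝ a b) := by
    rw [segment_eq_image']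
    exact isCompact_Icc.image (by fun_prop)
  have hex : Metric.infDist q (segment ℝ a b) ≤ r ↔ ∃ y ∈ segment ℝ a b, dist q y ≤ r := by
    constructor
    · intro h
      obtain ⟨y, hy, hd⟩ := hcomp.exists_infDist_eq_dist hne q
      exact ⟨y, hy, hd ▸ h⟩
    · rintro ⟨y, hy, hd⟩
      exact (Metric.infDist_le_dist_of_mem hy).trans hd
  rw [hex]
  simp only [hseg, hdist]
  obtain ⟨u, hu⟩ : ∃ u, u = b 0 - a 0 := ⟨_, rfl⟩
  obtain ⟨v, hv⟩ : ∃ v, v = b 1 - a 1 := ⟨_, rfl⟩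
  obtain ⟨x, hx⟩ : ∃ x, x = q 0 - a 0 := ⟨_, rfl⟩
  obtain ⟨y, hy⟩ : ∃ y, y = q 1 - a 1 := ⟨_, rfl⟩
  rw [← hu, ← hv, ← hx, ← hy, show q 0 - b 0 = x - u by rw [hx, hu]; ring,
    show q 1 - b 1 = y - v by rw [hy, hv]; ring, show a 0 - b 0 = -u by rw [hu]; ring,
    show a 1 - b 1 = -v by rw [hv]; ring]
  constructor
  · rintro ⟨z, ⟨t, h0, h1, hz0, hz1⟩, hd⟩
    rw [show q 0 - z 0 = x - t * u by rw [hz0, hx]; ring,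
      show q 1 - z 1 = y - t * v by rw [hz1, hy]; ring] at hd
    refine ⟨?_, fun h => ?_, fun h => ?_⟩
    · -- The cross product does not change if `q` is replaced by its difference to `z`.
      refine le_trans ?_ (mul_le_mul_of_nonneg_right hd (Real.sqrt_nonneg _))
      rw [← Real.sqrt_mul (add_nonneg (mul_self_nonneg _) (mul_self_nonneg _))]
      refine Real.abs_le_sqrt ?_
      nlinarith [sq_nonneg ((x - t * u) * u + (y - t * v) * v)]
    · refine (Real.sqrt_le_sqrt ?_).trans hd
      nlinarith [mul_nonneg h0 (neg_nonneg.2 h), mul_self_nonneg (t * u), mul_self_nonneg (t * v)]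
    · refine (Real.sqrt_le_sqrt ?_).trans hd
      nlinarith [mul_nonneg (sub_nonneg.2 h1) (neg_nonneg.2 h), mul_self_nonneg ((1 - t) * u),
        mul_self_nonneg ((1 - t) * v)]
  · rintro ⟨h1, h2, h3⟩
    by_cases c1 : x * u + y * v ≤ 0
    · exact ⟨a, ⟨0, le_rfl, zero_le_one, by ring, by ring⟩, by rw [← hx, ← hy]; exact h2 c1⟩
    by_cases c2 : (x - u) * -u + (y - v) * -v ≤ 0
    · refine ⟨b, ⟨1, zero_le_one, le_rfl, by rw [hu]; ring, by rw [hv]; ring⟩, ?_⟩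
      rw [show q 0 - b 0 = x - u by rw [hx, hu]; ring, show q 1 - b 1 = y - v by rw [hy, hv]; ring]
      exact h3 c2
    -- The orthogonal projection of `q` lies on the segment.
    rw [not_le] at c1 c2
    have hn : 0 < u * u + v * v := by nlinarith
    obtain ⟨t, ht⟩ : ∃ t, t = (x * u + y * v) / (u * u + v * v) := ⟨_, rfl⟩
    have ht' : t * (u * u + v * v) = x * u + y * v := by
      rw [ht, div_mul_cancel₀ _ hn.ne']
    refine ⟨!₂[a 0 + t * u, a 1 + t * v], ⟨t, by rw [ht]; positivity, ?_, by simp, by simp⟩, ?_⟩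
    · rw [ht, div_le_one hn]; linarith
    · have e0 : q 0 - (!₂[a 0 + t * u, a 1 + t * v] : EuclideanSpace ℝ (Fin 2)) 0 = x - t * u := by
        simp [hx]; ring
      have e1 : q 1 - (!₂[a 0 + t * u, a 1 + t * v] : EuclideanSpace ℝ (Fin 2)) 1 = y - t * v := by
        simp [hy]; ring
      rw [e0, e1]
      have hsn := Real.sqrt_pos.2 hn
      refine le_of_mul_le_mul_right (le_trans ?_ h1) hsn
      rw [← Real.sqrt_mul (add_nonneg (mul_self_nonneg _) (mul_self_nonneg _)),
        ← Real.sqrt_sq_eq_abs]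
      refine Real.sqrt_le_sqrt (le_of_eq ?_)
      linear_combination (t * (u * u + v * v) - (x * u + y * v)) * ht'

/-- A finite sequence of reals that starts at most at `τ` and ends at least at `τ` crosses `τ`. -/
theorem exists_crossing {φ : ℕ → ℝ} {τ : ℝ} {i j : ℕ} (hij : i < j) (hi : φ i ≤ τ) (hj : τ ≤ φ j) :
    ∃ k, i ≤ k ∧ k < j ∧ φ k ≤ τ ∧ τ ≤ φ (k + 1) := by
  induction j, hij using Nat.le_induction with
  | base => exact ⟨i, le_rfl, Nat.lt_succ_self i, hi, hj⟩
  | succ j hij ih =>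
    by_cases h : τ ≤ φ j
    · obtain ⟨k, h1, h2, h3⟩ := ih h
      exact ⟨k, h1, h2.trans (Nat.lt_succ_self j), h3⟩
    · exact ⟨j, by omega, Nat.lt_succ_self j, (not_le.1 h).le, hj⟩

/-- The orthogonal projections of the subcurve onto the line through its end points cover the
segment. Hence the points of the segment are not farther from the subcurve than the points of the
subcurve are from the segment, and the latter distance is a convex function on every edge. -/
theorem hausdorffDist_le_iff {n : ℕ} (p : Fin n → EuclideanSpace ℝ (Fin 2)) {i j : Fin n}
    (hij : i < j) {r : ℝ} (hr : 0 ≤ r) :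
    Metric.hausdorffDist (segment ℝ (p i) (p j)) (subcurve p i j) ≤ r ↔
      ∀ k, i ≤ k → k ≤ j → Metric.infDist (p k) (segment ℝ (p i) (p j)) ≤ r := by
  have hS : IsCompact (segment ℝ (p i) (p j)) := by
    rw [segment_eq_image']
    exact isCompact_Icc.image (by fun_prop)
  have hSne : (segment ℝ (p i) (p j)).Nonempty := ⟨_, left_mem_segment ℝ _ _⟩
  have hvert : ∀ k, i ≤ k → k ≤ j → p k ∈ subcurve p i j := by
    intro k hik hkj
    rcases hkj.lt_or_eq with h | rfl
    · exact ⟨k, ⟨k + 1, by omega⟩, hik, rfl, by simpa [Fin.le_def] using h, left_mem_segment ℝ _ _⟩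
    · have h0 : (i : ℕ) < k := hij
      refine ⟨⟨k - 1, by omega⟩, k, by simp [Fin.le_def]; omega, by simp; omega, le_rfl,
        right_mem_segment ℝ _ _⟩
  have hCne : (subcurve p i j).Nonempty := ⟨_, hvert i le_rfl hij.le⟩
  have hCb : Bornology.IsBounded (subcurve p i j) := by
    refine Bornology.IsBounded.subset
      (isBounded_convexHull.2 (Set.finite_range p).isBounded) ?_
    rintro x ⟨k, l, -, -, -, hx⟩
    exact (convex_convexHull ℝ _).segment_subset (subset_convexHull ℝ _ (Set.mem_range_self k))
      (subset_convexHull ℝ _ (Set.mem_range_self l)) hx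
  have hfin := Metric.hausdorffEDist_ne_top_of_nonempty_of_bounded hSne hCne hS.isBounded hCb
  constructor
  · intro h k hik hkj
    rw [Metric.hausdorffDist_comm] at h
    rw [Metric.hausdorffEDist_comm] at hfin
    exact (Metric.infDist_le_hausdorffDist_of_mem (hvert k hik hkj) hfin).trans h
  · intro h
    have hC : ∀ y ∈ subcurve p i j, Metric.infDist y (segment ℝ (p i) (p j)) ≤ r := by
      rintro y ⟨k, l, hik, hkl, hlj, hy⟩
      have hmem : ∀ z, Metric.infDist z (segment ℝ (p i) (p j)) ≤ r ↔
          z ∈ Metric.cthickening r (segment ℝ (p i) (p j)) := fun z => by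
        rw [Metric.mem_cthickening_iff, Metric.infDist,
          ENNReal.le_ofReal_iff_toReal_le (Metric.infEDist_ne_top hSne) hr]
      have hik' : i ≤ l := hik.trans (by rw [Fin.le_def]; omega)
      have hkj' : k ≤ j := le_trans (by rw [Fin.le_def]; omega) hlj
      rw [hmem]
      exact ((convex_segment (p i) (p j)).cthickening r).segment_subset
        ((hmem _).1 (h k hik hkj')) ((hmem _).1 (h l hik' hlj)) hy
    refine Metric.hausdorffDist_le_of_infDist hr (fun x hx => ?_) hC
    -- Find a point `y` of the subcurve whose projection is `x`.
    obtain ⟨y, hyC, hy⟩ : ∃ y ∈ subcurve p i j, inner ℝ (y - x) (p j - p i) = (0 : ℝ) := by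
      rw [segment_eq_image'] at hx
      obtain ⟨t, ⟨ht0, ht1⟩, rfl⟩ := hx
      obtain ⟨φ, hφ⟩ : ∃ φ : EuclideanSpace ℝ (Fin 2) → ℝ, ∀ z, φ z =
        inner ℝ (z - p i) (p j - p i) := ⟨_, fun _ => rfl⟩
      obtain ⟨k, hk1, hk2, hk3, hk4⟩ := exists_crossing
        (φ := fun k => if h : k < n then φ (p ⟨k, h⟩) else 0)
        (τ := t * inner ℝ (p j - p i) (p j - p i)) (i := i) (j := j) hij (by
          simp only [Fin.is_lt, dif_pos, Fin.eta, hφ, sub_self, inner_zero_left]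
          exact mul_nonneg ht0 real_inner_self_nonneg) (by
          simp only [Fin.is_lt, dif_pos, Fin.eta, hφ]
          exact mul_le_of_le_one_left real_inner_self_nonneg ht1)
      have hjn := j.is_lt
      rw [dif_pos (by omega)] at hk3 hk4
      -- On the edge, `φ` is affine.
      obtain ⟨θ, hθ0, hθ1, hθ⟩ : ∃ θ : ℝ, 0 ≤ θ ∧ θ ≤ 1 ∧
          φ (p ⟨k, by omega⟩) + θ * (φ (p ⟨k + 1, by omega⟩) - φ (p ⟨k, by omega⟩)) =
            t * inner ℝ (p j - p i) (p j - p i) := by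
        rcases hk3.lt_or_eq with h' | h'
        · have hpos : 0 < φ (p ⟨k + 1, by omega⟩) - φ (p ⟨k, by omega⟩) := by linarith
          refine ⟨(t * inner ℝ (p j - p i) (p j - p i) - φ (p ⟨k, by omega⟩)) /
            (φ (p ⟨k + 1, by omega⟩) - φ (p ⟨k, by omega⟩)), div_nonneg (by linarith) hpos.le,
            (div_le_one hpos).2 (by linarith), ?_⟩
          rw [div_mul_cancel₀ _ hpos.ne']; ring
        · exact ⟨0, le_rfl, zero_le_one, by rw [h']; ring⟩
      refine ⟨p ⟨k, by omega⟩ + θ • (p ⟨k + 1, by omega⟩ - p ⟨k, by omega⟩),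
        ⟨⟨k, by omega⟩, ⟨k + 1, by omega⟩, hk1, rfl, ?_, ?_⟩, ?_⟩
      · simp [Fin.le_def]; omega
      · rw [segment_eq_image']; exact ⟨θ, ⟨hθ0, hθ1⟩, rfl⟩
      · rw [hφ, hφ] at hθ
        simp only [inner_sub_left, inner_add_left, inner_smul_left, RCLike.conj_to_real] at hθ ⊢
        linarith
    have hsegex : ∃ z ∈ segment ℝ (p i) (p j), dist y z ≤ r := by
      obtain ⟨z, hz, hd⟩ := hS.exists_infDist_eq_dist hSne y
      exact ⟨z, hz, hd ▸ hC y hyC⟩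
    obtain ⟨z, hz, hd⟩ := hsegex
    refine (Metric.infDist_le_dist_of_mem hyC).trans (le_trans ?_ hd)
    -- By orthogonality, `x` is a nearest point to `y` on the line.
    have horth : inner ℝ (y - x) (x - z) = (0 : ℝ) := by
      rw [segment_eq_image'] at hx hz
      obtain ⟨t, -, rfl⟩ := hx
      obtain ⟨t', -, rfl⟩ := hz
      rw [show p i + t • (p j - p i) - (p i + t' • (p j - p i)) = (t - t') • (p j - p i) by
        rw [sub_smul]; abel, inner_smul_right, hy, mul_zero]
    rw [dist_comm, dist_eq_norm, dist_eq_norm]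
    have hsq := norm_add_sq_eq_norm_sq_add_norm_sq_of_inner_eq_zero (y - x) (x - z) horth
    rw [sub_add_sub_cancel] at hsq
    nlinarith [norm_nonneg (y - z), norm_nonneg (y - x), mul_self_nonneg ‖x - z‖]

/-! ### Conclusion -/

theorem cell_inj {n x y x' y' : ℕ} (hy : y < n) (hy' : y' < n) (h : x * n + y = x' * n + y') :
    x = x' ∧ y = y' := by
  have hn : 0 < n := by omega
  have h1 : (x * n + y) / n = x := by rw [Nat.div_eq_iff hn]; omega
  have h2 : (x' * n + y') / n = x' := by rw [Nat.div_eq_iff hn]; omega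
  have hx : x = x' := by rw [← h1, h, h2]
  subst hx
  exact ⟨rfl, by omega⟩

/-- Only two sweeps raise the cell of the pair `(i, j)`: those from `i` to `j` and from `j` to
`i`. -/
theorem cell_iff {n i j : ℕ} (hij : i < j) (hj : j < n) {P Q : ℕ → ℕ → Prop} :
    (∀ i' < n, (∀ c < n - i', i' * n + (i' + c) = i * n + j → P i' c) ∧
      (∀ c < i' + 1, (i' - c) * n + i' = i * n + j → Q i' c)) ↔ P i (j - i) ∧ Q j (j - i) := by
  constructor
  · intro H
    refine ⟨(H i (by omega)).1 _ (by omega) ?_, (H j hj).2 _ (by omega) ?_⟩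
    · rw [Nat.add_sub_of_le hij.le]
    · rw [Nat.sub_sub_self hij.le]
  · rintro ⟨h1, h2⟩ i' hi'
    refine ⟨fun c hc h => ?_, fun c hc h => ?_⟩
    · obtain ⟨rfl, h'⟩ := cell_inj (by omega) hj h
      rwa [show c = j - i' by omega]
    · obtain ⟨h', rfl⟩ := cell_inj hi' hj h
      rwa [show c = i' - i by omega]

/-- The distances from the two rays together determine the Hausdorff distance. -/
theorem rays_iff_hausdorffDist {n : ℕ} (p : Fin n → EuclideanSpace ℝ (Fin 2)) {i j : Fin n}
    (hij : i < j) {b : ℝ} (hb : 0 ≤ b) {X Y : ℕ → ℝ} (hX : ∀ k : Fin n, X k = p k 0)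
    (hY : ∀ k : Fin n, Y k = p k 1) :
    (RealRAM.RayLE (fun c => X (i + c) - X i) (fun c => Y (i + c) - Y i) (j - i) b ∧
      RealRAM.RayLE (fun c => X (j - c) - X j) (fun c => Y (j - c) - Y j) (j - i) b) ↔
    Metric.hausdorffDist (segment ℝ (p i) (p j)) (subcurve p i j) ≤ b := by
  have hij' : (i : ℕ) < j := hij
  rw [hausdorffDist_le_iff p hij hb]
  simp only [infDist_segment_le_iff, ← hX, ← hY]
  unfold RealRAM.RayLE
  have e1 : (i : ℕ) + (j - i) = j := by omega
  have e2 : (j : ℕ) - (j - i) = i := by omega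
  simp only [e1, e2]
  constructor
  · rintro ⟨h1, h2⟩ k hik hkj
    have hik' : (i : ℕ) ≤ k := hik
    have hkj' : (k : ℕ) ≤ j := hkj
    have a1 := h1 (k - i) (by omega)
    have a2 := h2 (j - k) (by omega)
    rw [Nat.add_sub_of_le hik'] at a1
    rw [Nat.sub_sub_self hkj'] at a2
    exact ⟨a1.1, a1.2, a2.2⟩
  · intro h
    refine ⟨fun k hk => ?_, fun k hk => ?_⟩
    · obtain ⟨h1, h2, -⟩ := h ⟨i + k, by omega⟩ (by simp [Fin.le_def]) (by
        simp only [Fin.le_def]; omega)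
      exact ⟨h1, h2⟩
    · obtain ⟨h1, -, h3⟩ := h ⟨j - k, by omega⟩ (by simp only [Fin.le_def]; omega) (by
        simp [Fin.le_def])
      refine ⟨?_, h3⟩
      -- The distance from the line does not depend on the choice of the base point.
      rw [abs_sub_comm]
      convert h1 using 2
      · simp only; ring
      · congr 1; ring

theorem steps_isBigO (K : ℕ) :
    (fun n : ℕ => ((K * ((n + 1) * (2 ^ Nat.clog 2 n * (Nat.clog 2 n + 1))) : ℕ) : ℝ)) =O[atTop]
      fun n : ℕ => (n : ℝ) ^ 2 * Real.log (n : ℝ) := by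
  refine IsBigO.of_bound (20 * K) ?_
  filter_upwards [eventually_ge_atTop 2] with n hn
  obtain ⟨h, hh⟩ : ∃ h, Nat.clog 2 n = h + 1 :=
    ⟨Nat.clog 2 n - 1, by have := Nat.clog_pos (b := 2) (by norm_num) hn; omega⟩
  have hlt : 2 ^ h < n := by
    have := Nat.pow_pred_clog_lt_self (b := 2) (by norm_num) (x := n) (by omega)
    rwa [hh] at this
  have hlt' : (2 : ℝ) ^ h ≤ n := by exact_mod_cast hlt.le
  have hn' : (2 : ℝ) ≤ n := by exact_mod_cast hn
  have hlog2 := Real.log_two_gt_d9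
  have hl : Real.log 2 ≤ Real.log n := Real.log_le_log (by norm_num) hn'
  have hl' : h * Real.log 2 ≤ Real.log n := by
    rw [← Real.log_pow]
    exact Real.log_le_log (by positivity) hlt'
  have hh0 : (0 : ℝ) ≤ h := Nat.cast_nonneg _
  have b3 : (h : ℝ) + 2 ≤ 5 * Real.log n := by nlinarith
  rw [hh, Real.norm_of_nonneg (Nat.cast_nonneg _),
    Real.norm_of_nonneg (mul_nonneg (sq_nonneg _) (by linarith))]
  push_cast
  have b1 : (n : ℝ) + 1 ≤ 2 * n := by linarith
  have b2 : (2 : ℝ) ^ (h + 1) ≤ 2 * n := by rw [pow_succ]; linarith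
  calc (K : ℝ) * ((n + 1) * (2 ^ (h + 1) * (h + 1 + 1)))
      ≤ K * (2 * n * (2 * n * (5 * Real.log n))) := by gcongr; linarith
    _ = _ := by ring

theorem mainTheorem3 :
    ∃ (P : RealRAM.Prog) (T : ℕ → ℕ),
      ((fun n : ℕ => (T n : ℝ)) =O[atTop] fun n : ℕ => (n : ℝ) ^ 2 * Real.log (n : ℝ)) ∧
      ∀ (n : ℕ) (p : Fin n → EuclideanSpace ℝ (Fin 2)),
        ∃ (s : RealRAM.State) (t : ℕ),
          RealRAM.Exec P (RealRAM.input p) s t ∧ t ≤ T n ∧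
          ∀ i j : Fin n, i < j →
            s.realArr 2 ((i : ℕ) * n + (j : ℕ)) =
              Metric.hausdorffDist (segment ℝ (p i) (p j)) (subcurve p i j) := by
  obtain ⟨K, hK⟩ := RealRAM.hausdorffProg_runs
  refine ⟨RealRAM.hausdorffProg, _, steps_isBigO K, fun n p => ?_⟩
  obtain ⟨s, t, he, ht, H0, H⟩ := hK (RealRAM.input p) n _ _ (by simp [RealRAM.input]) rfl rfl
    (by simp [RealRAM.input])
  refine ⟨s, t, he, ht, fun i j hij => ?_⟩
  have key : ∀ b, 0 ≤ b → (s.realArr 2 ((i : ℕ) * n + (j : ℕ)) ≤ b ↔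
      Metric.hausdorffDist (segment ℝ (p i) (p j)) (subcurve p i j) ≤ b) := by
    intro b hb
    rw [H _ b hb, cell_iff (i := i) (j := j) hij j.is_lt]
    exact rays_iff_hausdorffDist p hij hb (fun k => by simp [RealRAM.input])
      (fun k => by simp [RealRAM.input])
  exact le_antisymm ((key _ Metric.hausdorffDist_nonneg).2 le_rfl) ((key _ (H0 _)).1 le_rfl)

end
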